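/- \textbf{Setting.} Let $\mathcal L_\alpha,\mathcal L_\beta$ be first-order languages such that every function symbol of $\mathcal L_\alpha$ (constants being nullary functions) lies in $\mathcal L_\beta$. Put $\mathcal L=\mathcal L_\alpha\cap\mathcal L_\beta$ and $\mathcal L^2=\mathcal L_\alpha\cup\mathcal L_\beta\cup\{A\}$ with $A$ a new unary predicate. Let $T_\alpha$, $T_\beta$ be consistent theories in $\mathcal L_\alpha$, $\mathcal L_\beta$. For an $\mathcal L_\alpha$-formula $\theta$ let $\theta_A$ be the formula obtained by relativizing all quantifiers to $A$. Let $T^2$ be the $\mathcal L^2$-theory consisting of $T_\beta$, of all $\phi_A$ with $T_\alpha\models\phi$, of the axioms saying that $A$ is closed under each function symbol of $\mathcal L_\alpha$, and of the axioms $R(x_1,\dots,x_n)\to\bigwedge_i A(x_i)$ for each relation symbol $R\in\mathcal L_\alpha\setminus\mathcal L_\beta$. A model of $T^2$ is written $(\mathcal B,\mathcal A)$, where $\mathcal B$ is its $\mathcal L_\beta$-reduct with universe $B$, and $\mathcal A$ is the $\mathcal L_\alpha$-structure induced on the set $A$ defined by the predicate. Assume that $T_\beta$ is geometric: it eliminates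 $\exists^\infty$, and the algebraic closure $\operatorname{acl}$ is a pregeometry in every model. Throughout, $\operatorname{acl}$ is computed in $\mathcal B$, and $X\perp_Z Y$ (``$X$ and $Y$ are independent over $Z$'') means that every subset of $X$ that is $\operatorname{acl}$-independent over $Z$ is $\operatorname{acl}$-independent over $Y\cup Z$. Put $|T^2|=\max(\aleph_0,|\mathcal L^2|)$. Types are complete. For a tuple $\vec c$ in $B$ let $\vec c_\alpha$ be the subtuple of its components in $A$. A \emph{Mordell--Lang challenge} is $(p(\vec x_\alpha),q(\vec x),\phi(\vec x,y),\psi(\vec x_\alpha,y))$ with $\vec x_\alpha$ a subtuple of the finite tuple $\vec x$, $p$ an $\mathcal L_\alpha$-type of $T_\alpha$, $q$ an $\mathcal L_\beta$-type of $T_\beta$, $\phi$ an $\mathcal L_\beta$-formula, $\psi$ an $\mathcal L_\alpha$-formula, and $q(\vec x)\models\exists^{<\infty}y\,\phi(\vec x,y)$. For an $\mathcal L^2$-theory $T\supseteq T^2$, a \emph{contender} is a pair $((\mathcal B,\mathcal A),\vec c)$ with $(\mathcal B,\mathcal A)\models T$ such that $\vec c$ realizes $q$, the subtuple $\vec c_\alpha$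 (which has exactly the variables $\vec x_\alpha$) realizes $p_A=\{\theta_A:\theta\in p\}$, and $\vec c\perp_{\vec c_\alpha}A$. A \emph{solution} is a contender together with $a\in A$ such that $\phi(\vec c,a)\wedge\psi_A(\vec c_\alpha,a)$ holds. An \emph{ML-theory} is an $\mathcal L^2$-theory $T\supseteq T^2$ such that (i) for every challenge that has a solution in some model of $T$, and for every contender $((\mathcal B,\mathcal A),\vec c)$ to it, there is $a\in A$ such that $((\mathcal B,\mathcal A),\vec c,a)$ is a solution; (ii) for every $\kappa>|T^2|$, every $\kappa$-saturated $(\mathcal B,\mathcal A)\models T$, every $C\subseteq B$ with $|C|<\kappa$ and every non-algebraic unary $\mathcal L_\beta(C)$-type $q$: for each unary $\mathcal L_\alpha(A\cap C)$-type $p$ of $\mathcal A$ such that $q$ implies every quantifier-free $\mathcal L(A\cap C)$-formula in $p$, some $a\in A$ realizes $p_A\cup q$ (density); and some $b\in B\setminus\operatorname{acl}(A\cup C)$ realizes $q$ (codensity). \textbf{Theorem.} Let $T$ be a consistent ML-theory, let $\kappa>|T^2|$, and let $(\mathcal B_1^*,\mathcal A_1^*)$ and $(\mathcal B_2^*,\mathcal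 A_2^*)$ be $\kappa$-saturated models of $T$. Let $\mathcal I$ be the set of all partial $\mathcal L_\beta$-elementary maps $\iota:B_1\to B_2$ between finite sets $B_1\subseteq B_1^*$, $B_2\subseteq B_2^*$ (with $\iota(B_1)=B_2$) such that, with $A_i=A_i^*\cap B_i$, (1) $B_1\perp_{A_1}A_1^*$ and $B_2\perp_{A_2}A_2^*$; (2) $\iota(A_1)=A_2$; (3) $\iota|_{A_1}$ is a partial $\mathcal L_\alpha$-elementary map from $\mathcal A_1^*$ to $\mathcal A_2^*$. Then $\mathcal I$ is a back-and-forth system in the language $\mathcal L^2$: each $\iota\in\mathcal I$ is a partial $\mathcal L^2$-isomorphism (it preserves and reflects quantifier-free $\mathcal L^2$-formulas); for all $\iota\in\mathcal I$ and $b\in B_1^*$ there is $\iota'\in\mathcal I$ extending $\iota$ with $b$ in its domain; and for all $\iota\in\mathcal I$ and $b\in B_2^*$ there is $\iota'\in\mathcal I$ extending $\iota$ with $b$ in its range. Moreover, each map $\iota\in\mathcal I$ is partial $\mathcal L^2$-elementary. -/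

import Mathlib

open FirstOrder FirstOrder.Language Set

universe u v w

namespace MLPair

/-! ### General model theory -/

section General

variable (L : FirstOrder.Language.{u, v}) {M : Type w} [L.Structure M]

/-- Algebraic closure: the union of all finite sets definable with parameters from `X`. -/
def acl (X : Set M) : Set M :=
  {y | ∃ s : Set M, X.Definable₁ L s ∧ s.Finite ∧ y ∈ s}

/-- `X` is `acl`-independent over `Z`. -/
def AclIndepOver (X Z : Set M) : Prop :=
  ∀ x ∈ X, x ∉ acl L (Z ∪ (X \ {x}))

/-- `X` and `Y` are independent over `Z`. -/
def IndepSets (X Y Z : Set M) : Prop :=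
  ∀ X₀ ⊆ X, AclIndepOver L X₀ Z → AclIndepOver L X₀ (Y ∪ Z)

/-- The solutions `y` of `φ(c, y)`. -/
def solutions {γ : Type*} (φ : L.Formula (γ ⊕ Unit)) (c : γ → M) : Set M :=
  {y | φ.Realize (Sum.elim c fun _ => y)}

/-- A set of formulas in one variable with parameters from `C` (the parameters are the variables
indexed by `C`) that is finitely satisfiable in `M`. -/
def FinitelySatisfiable {C : Set M} (q : Set (L.Formula (C ⊕ Unit))) : Prop :=
  ∀ q₀ : Set (L.Formula (C ⊕ Unit)), q₀ ⊆ q → q₀.Finite →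
    ∃ y : M, ∀ φ ∈ q₀, y ∈ solutions L φ ((↑) : C → M)

/-- `q` is a (complete) unary type over `C`. -/
def IsTypeOver {C : Set M} (q : Set (L.Formula (C ⊕ Unit))) : Prop :=
  FinitelySatisfiable L q ∧ ∀ φ, φ ∈ q ∨ φ.not ∈ q

/-- `q` is non-algebraic: none of its formulas has only finitely many solutions. -/
def NonAlgebraic {C : Set M} (q : Set (L.Formula (C ⊕ Unit))) : Prop :=
  ∀ φ ∈ q, (solutions L φ ((↑) : C → M)).Infinite

variable (M) in
/-- `κ`-saturation: every finitely satisfiable set of formulas in one variable over fewer than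
`κ` parameters is realized. -/
def IsSaturated (κ : Cardinal.{w}) : Prop :=
  ∀ C : Set M, Cardinal.mk C < κ → ∀ q : Set (L.Formula (C ⊕ Unit)), FinitelySatisfiable L q →
    ∃ y : M, ∀ φ ∈ q, y ∈ solutions L φ ((↑) : C → M)

variable {L} in
/-- The tuple `c` realizes the complete type `p`. -/
def RealizesType {T : L.Theory} {γ : Type*} (p : T.CompleteType γ) (c : γ → M) : Prop :=
  ∀ φ : L.Formula γ, Formula.equivSentence φ ∈ p → φ.Realize c

end General

/-- A pregeometry (finitary closure operator with the exchange property). -/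
structure IsPregeometry {M : Type w} (cl : Set M → Set M) : Prop where
  subset_cl : ∀ X, X ⊆ cl X
  mono : ∀ X Y, X ⊆ Y → cl X ⊆ cl Y
  idem : ∀ X, cl (cl X) ⊆ cl X
  finitary : ∀ X, ∀ x ∈ cl X, ∃ X₀ ⊆ X, X₀.Finite ∧ x ∈ cl X₀
  exchange : ∀ X x y, x ∈ cl (insert y X) → x ∉ cl X → y ∈ cl (insert x X)

/-- A theory is geometric if it eliminates the quantifier "there are infinitely many" and
`acl` is a pregeometry in each of its models. -/
structure IsGeometric {L : FirstOrder.Language.{u, v}} (T : L.Theory) : Prop where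
  eliminates_exists_infinity : ∀ (n : ℕ) (φ : L.Formula (Fin n ⊕ Unit)), ∃ θ : L.Formula (Fin n),
    ∀ (M : Type w) [L.Structure M] [Nonempty M] [M ⊨ T] (c : Fin n → M),
      θ.Realize c ↔ (solutions L φ c).Infinite
  pregeometry : ∀ (M : Type w) [L.Structure M] [Nonempty M] [M ⊨ T],
    IsPregeometry (acl L : Set M → Set M)

/-! ### Partial maps -/

/-- A partial map from `M` to `N`, given by its graph. -/
structure PartialMap (M N : Type w) where
  graph : Set (M × N)
  functional : ∀ ⦃a b b'⦄, (a, b) ∈ graph → (a, b') ∈ graph → b = b'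

namespace PartialMap

variable {M N : Type w}

def dom (f : PartialMap M N) : Set M := {a | ∃ b, (a, b) ∈ f.graph}

def ran (f : PartialMap M N) : Set N := {b | ∃ a, (a, b) ∈ f.graph}

def image (f : PartialMap M N) (X : Set M) : Set N := {b | ∃ a ∈ X, (a, b) ∈ f.graph}

def Extends (g f : PartialMap M N) : Prop := f.graph ⊆ g.graph

/-- The part of `f` that goes from the substructure `P` to the substructure `Q`. -/
def restrict {L : FirstOrder.Language.{u, v}} [L.Structure M] [L.Structure N] (f : PartialMap M N)
    (P : L.Substructure M) (Q : L.Substructure N) : PartialMap P Q where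
  graph := {p | ((p.1 : M), (p.2 : N)) ∈ f.graph}
  functional _ _ _ h h' := Subtype.ext (f.functional h h')

variable (L : FirstOrder.Language.{u, v}) [L.Structure M] [L.Structure N]

/-- `f` is partial elementary: every formula evaluated at elements of the domain has the same
truth value at their images. The variables of the formula are indexed by the pairs `(a, f a)`. -/
def IsElementary (f : PartialMap M N) : Prop :=
  ∀ φ : L.Formula f.graph, φ.Realize (fun p => p.1.1) ↔ φ.Realize (fun p => p.1.2)

/-- `f` is a partial isomorphism: it preserves and reflects all quantifier-free formulas. -/
def IsPartialIso (f : PartialMap M N) : Prop :=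
  ∀ φ : L.Formula f.graph, φ.IsQF →
    (φ.Realize (fun p => p.1.1) ↔ φ.Realize (fun p => p.1.2))

/-- A back-and-forth system of partial isomorphisms between `M` and `N`. -/
structure IsBackAndForthSystem (I : Set (PartialMap M N)) : Prop where
  partialIso : ∀ f ∈ I, f.IsPartialIso L
  forth : ∀ f ∈ I, ∀ a : M, ∃ g ∈ I, g.Extends f ∧ a ∈ g.dom
  back : ∀ f ∈ I, ∀ b : N, ∃ g ∈ I, g.Extends f ∧ b ∈ g.ran

end PartialMap

/-! ### The two languages and the language of pairs -/

/-- A set of function and relation symbols taken from `S`. -/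
structure SymbolSet (S : FirstOrder.Language.{u, v}) where
  funs : ∀ n, Set (S.Functions n)
  rels : ∀ n, Set (S.Relations n)

namespace SymbolSet

variable {S : FirstOrder.Language.{u, v}}

/-- The language whose symbols are those in `X`. -/
def lang (X : SymbolSet S) : FirstOrder.Language.{u, v} := ⟨fun n => X.funs n, fun n => X.rels n⟩

def inter (X Y : SymbolSet S) : SymbolSet S :=
  ⟨fun n => X.funs n ∩ Y.funs n, fun n => X.rels n ∩ Y.rels n⟩

def union (X Y : SymbolSet S) : SymbolSet S :=
  ⟨fun n => X.funs n ∪ Y.funs n, fun n => X.rels n ∪ Y.rels n⟩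

def inclusion {X Y : SymbolSet S} (hf : ∀ n, X.funs n ⊆ Y.funs n)
    (hr : ∀ n, X.rels n ⊆ Y.rels n) : X.lang →ᴸ Y.lang :=
  ⟨fun n f => ⟨f.1, hf n f.2⟩, fun n r => ⟨r.1, hr n r.2⟩⟩

end SymbolSet

/-- The single symbol of the language that consists of one unary predicate. -/
inductive PredSymbol : ℕ → Type v
  | A : PredSymbol 1

def predLanguage : FirstOrder.Language.{u, v} := ⟨fun _ => PEmpty, PredSymbol⟩

/-- Consistent theories `Tα`, `Tβ` in languages `Lα`, `Lβ` (whose symbols come from a common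
supply `S`) such that every function symbol of `Lα` belongs to `Lβ`. -/
structure PairSetup (S : FirstOrder.Language.{u, v}) where
  α : SymbolSet S
  β : SymbolSet S
  funs_subset : ∀ n, α.funs n ⊆ β.funs n
  theoryα : α.lang.Theory
  theoryβ : β.lang.Theory
  consistent_α : theoryα.IsSatisfiable
  consistent_β : theoryβ.IsSatisfiable

namespace PairSetup

variable {S : FirstOrder.Language.{u, v}} (D : PairSetup S)

def Lα : FirstOrder.Language.{u, v} := D.α.lang

def Lβ : FirstOrder.Language.{u, v} := D.β.lang

def Tα : D.Lα.Theory := D.theoryα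

def Tβ : D.Lβ.Theory := D.theoryβ

/-- The common part of `Lα` and `Lβ`. -/
def L : FirstOrder.Language.{u, v} := (D.α.inter D.β).lang

/-- The language `Lα ∪ Lβ ∪ {A}` of pairs. -/
def L2 : FirstOrder.Language.{u, v} := (D.α.union D.β).lang.sum predLanguage.{u, v}

def inclLα : D.L →ᴸ D.Lα :=
  SymbolSet.inclusion (fun _ => inter_subset_left) (fun _ => inter_subset_left)

def inclLβ : D.L →ᴸ D.Lβ :=
  SymbolSet.inclusion (fun _ => inter_subset_right) (fun _ => inter_subset_right)

def inclα : D.Lα →ᴸ D.L2 :=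
  LHom.sumInl.comp
    (SymbolSet.inclusion (fun _ => subset_union_left) (fun _ => subset_union_left))

def inclβ : D.Lβ →ᴸ D.L2 :=
  LHom.sumInl.comp
    (SymbolSet.inclusion (fun _ => subset_union_right) (fun _ => subset_union_right))

def symbA : D.L2.Relations 1 := Sum.inr PredSymbol.A

/-- The formula `A(t)`. -/
def formA {γ : Type*} {n : ℕ} (t : D.L2.Term (γ ⊕ Fin n)) : D.L2.BoundedFormula γ n :=
  D.symbA.boundedFormula₁ t

/-- Relativization of all quantifiers of an `Lα`-formula to the predicate `A`. -/
def relativize {γ : Type*} : ∀ {n : ℕ}, D.Lα.BoundedFormula γ n → D.L2.BoundedFormula γ n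
  | _, .falsum => .falsum
  | _, .equal t₁ t₂ => .equal (D.inclα.onTerm t₁) (D.inclα.onTerm t₂)
  | _, .rel R ts => .rel (D.inclα.onRelation R) (fun i => D.inclα.onTerm (ts i))
  | _, .imp φ ψ => .imp (relativize φ) (relativize ψ)
  | n, .all φ => .all ((D.formA (Term.var (Sum.inr (Fin.last n)))).imp (relativize φ))

/-- `A` is closed under the function symbol `f` of `Lα`. -/
noncomputable def axiomT1 {n : ℕ} (f : D.Lα.Functions n) : D.L2.Sentence :=
  ((BoundedFormula.iInf fun i : Fin n => D.formA (γ := Empty) (Term.var (Sum.inr i))).imp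
    (D.formA (Term.func (D.inclα.onFunction f) fun i => Term.var (Sum.inr i)))).alls

/-- The relation symbol `R` of `Lα` only holds on tuples from `A`. -/
noncomputable def axiomT2 {n : ℕ} (R : D.Lα.Relations n) : D.L2.Sentence :=
  ((BoundedFormula.rel (D.inclα.onRelation R) fun i => Term.var (Sum.inr i)).imp
    (BoundedFormula.iInf fun i : Fin n =>
      D.formA (γ := Empty) (Term.var (Sum.inr i)))).alls

/-- The base theory of pairs. -/
def T2 : D.L2.Theory :=
  D.inclβ.onTheory D.Tβ ∪
    {σ | ∃ φ : D.Lα.Sentence, (D.Tα ⊨ᵇ φ) ∧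
      σ = D.relativize φ} ∪
    {σ | ∃ (n : ℕ) (f : D.Lα.Functions n), σ = D.axiomT1 f} ∪
    {σ | ∃ (n : ℕ) (R : D.Lα.Relations n), R.1 ∉ D.β.rels n ∧ σ = D.axiomT2 R}

/-- The cardinality `|T²|`: that of the language `L2`, but at least `ℵ₀`. -/
noncomputable def cardT2 : Cardinal.{max u v} := max Cardinal.aleph0 D.L2.card

section Structures

variable (M : Type w) [D.L2.Structure M]

instance reductα : D.Lα.Structure M := D.inclα.reduct M

/-- The structure `𝓑` of a pair. -/
instance reductβ : D.Lβ.Structure M := D.inclβ.reduct M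

/-- The set `A` of a pair. -/
def setA : Set M := {x | Structure.RelMap D.symbA ![x]}

variable {M} in
theorem funMap_mem_setA (hM : M ⊨ D.T2) {n : ℕ} (f : D.Lα.Functions n) (x : Fin n → M)
    (hx : ∀ i, x i ∈ D.setA M) : Structure.funMap f x ∈ D.setA M := by
  have h : M ⊨ D.axiomT1 f := hM.realize_of_mem _ (Or.inl (Or.inr ⟨n, f, rfl⟩))
  have h' := (BoundedFormula.realize_alls.1 h) x
  simp only [BoundedFormula.realize_imp, BoundedFormula.realize_iInf, formA,
    BoundedFormula.realize_rel₁] at h'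
  exact h' hx

/-- The `Lα`-structure `𝓐` of a pair, with underlying set `A`. -/
def partA [hM : M ⊨ D.T2] : D.Lα.Substructure M where
  carrier := D.setA M
  fun_mem f x hx := D.funMap_mem_setA hM f x hx

end Structures

/-! ### The Mordell-Lang condition and ML-theories -/

/-- A Mordell-Lang challenge. The subtuple of variables ranging over `A` is given by the set
`xα` of its indices. -/
structure Challenge where
  n : ℕ
  xα : Set (Fin n)
  p : D.Tα.CompleteType xα
  q : D.Tβ.CompleteType (Fin n)
  φ : D.Lβ.Formula (Fin n ⊕ Unit)
  ψ : D.Lα.Formula (xα ⊕ Unit)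
  /-- `q(x)` implies that `φ(x, y)` has only finitely many solutions `y`. -/
  finite : ∀ (N : Theory.ModelType.{u, v, max u v} D.Tβ) (c : Fin n → N),
    RealizesType q c → (solutions D.Lβ φ c).Finite

section Challenge

variable {D} (χ : D.Challenge) {M : Type w} [D.L2.Structure M]

/-- `c` realizes `q`, the subtuple `c_α` of all components in `A` has the variables `xα` and
realizes the relativization of `p`, and `c` is independent from `A` over `c_α`. -/
structure IsContender (c : Fin χ.n → M) : Prop where
  mem_iff : ∀ i, c i ∈ D.setA M ↔ i ∈ χ.xα
  realizes_q : RealizesType χ.q c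
  realizes_p : ∀ θ : D.Lα.Formula χ.xα, Formula.equivSentence θ ∈ χ.p →
    Formula.Realize (D.relativize θ) (fun i => c i)
  indep : IndepSets D.Lβ (range c) (D.setA M) (c '' χ.xα)

structure IsSolution (c : Fin χ.n → M) (a : M) : Prop where
  contender : IsContender χ c
  mem : a ∈ D.setA M
  realize_φ : χ.φ.Realize (Sum.elim c fun _ => a)
  realize_ψ : Formula.Realize (D.relativize χ.ψ) (Sum.elim (fun i : χ.xα => c i) fun _ => a)

end Challenge

/-- The Mordell-Lang condition for a theory `T` of pairs. -/
def MordellLangCondition (T : D.L2.Theory) : Prop :=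
  ∀ χ : D.Challenge,
    (∃ (M : Type w) (_ : D.L2.Structure M) (_ : M ⊨ T) (c : Fin χ.n → M) (a : M),
      IsSolution χ c a) →
    ∀ (M : Type w) [D.L2.Structure M] [M ⊨ T] (c : Fin χ.n → M), IsContender χ c →
      ∃ a : M, IsSolution χ c a

section Density

variable (M : Type w) [D.L2.Structure M]

/-- The elements of `𝓐` that lie in `C`. -/
def paramsA [M ⊨ D.T2] (C : Set M) : Set (D.partA M) := {a | (a : M) ∈ C}

/-- Regard an `L`-formula over `A ∩ C` as an `Lβ`-formula over `C`. -/
def toLβOver [M ⊨ D.T2] (C : Set M) (θ : D.L.Formula (D.paramsA M C ⊕ Unit)) :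
    D.Lβ.Formula (C ⊕ Unit) :=
  (D.inclLβ.onFormula θ).relabel
    (Sum.map (fun a : D.paramsA M C => (⟨((a : D.partA M) : M), a.2⟩ : C)) id)

/-- The density condition for the parameter set `C` and the `Lβ(C)`-type `q`: every
`Lα(A ∩ C)`-type `p` whose quantifier-free `L`-part follows from `q` is realized together with
`q` by an element of `A`. -/
def DensityFor [M ⊨ D.T2] (C : Set M) (q : Set (D.Lβ.Formula (C ⊕ Unit))) : Prop :=
  ∀ p : Set (D.Lα.Formula (D.paramsA M C ⊕ Unit)), IsTypeOver D.Lα p →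
    (∀ θ : D.L.Formula (D.paramsA M C ⊕ Unit), θ.IsQF →
      D.inclLα.onFormula θ ∈ p → D.toLβOver M C θ ∈ q) →
    ∃ a ∈ D.setA M,
      (∀ ψ ∈ p, Formula.Realize (D.relativize ψ)
        (Sum.elim (fun c : D.paramsA M C => ((c : D.partA M) : M)) fun _ => a)) ∧
      ∀ φ ∈ q, a ∈ solutions D.Lβ φ ((↑) : C → M)

/-- The codensity condition for the parameter set `C` and the `Lβ(C)`-type `q`. -/
def CodensityFor (C : Set M) (q : Set (D.Lβ.Formula (C ⊕ Unit))) : Prop :=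
  ∃ b : M, b ∉ acl D.Lβ (D.setA M ∪ C) ∧ ∀ φ ∈ q, b ∈ solutions D.Lβ φ ((↑) : C → M)

end Density

/-- `T` is a Mordell-Lang theory of pairs. (In the last clause, being a model of `T2` follows from
being a model of `T`.) -/
structure IsMLTheory (T : D.L2.Theory) : Prop where
  extends_T2 : D.T2 ⊆ T
  mordellLang : MordellLangCondition.{u, v, w} D T
  density_codensity : ∀ κ : Cardinal.{w},
    Cardinal.lift.{w} D.cardT2 < Cardinal.lift.{max u v} κ →
    ∀ (M : Type w) [D.L2.Structure M] [M ⊨ D.T2] [M ⊨ T], IsSaturated D.L2 M κ →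
    ∀ C : Set M, Cardinal.mk C < κ →
    ∀ q : Set (D.Lβ.Formula (C ⊕ Unit)), IsTypeOver D.Lβ q → NonAlgebraic D.Lβ q →
      D.DensityFor M C q ∧ D.CodensityFor M C q

/-! ### The family of maps -/

/-- The finite partial `Lβ`-elementary maps `ι : B₁ → B₂` such that `Bᵢ` is independent from `A`
over `A ∩ Bᵢ`, `ι (A ∩ B₁) = A ∩ B₂`, and the restriction of `ι` to `A ∩ B₁` is a partial
`Lα`-elementary map between the structures `𝓐`. -/
structure IsMLMap {M N : Type w} [D.L2.Structure M] [D.L2.Structure N] [M ⊨ D.T2] [N ⊨ D.T2]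
    (f : PartialMap M N) : Prop where
  finite : f.graph.Finite
  elementary_β : f.IsElementary D.Lβ
  indep_dom : IndepSets D.Lβ f.dom (D.setA M) (D.setA M ∩ f.dom)
  indep_ran : IndepSets D.Lβ f.ran (D.setA N) (D.setA N ∩ f.ran)
  image_A : f.image (D.setA M ∩ f.dom) = D.setA N ∩ f.ran
  elementary_α : (f.restrict (D.partA M) (D.partA N)).IsElementary D.Lα

def mlMaps (M N : Type w) [D.L2.Structure M] [D.L2.Structure N] [M ⊨ D.T2] [N ⊨ D.T2] :
    Set (PartialMap M N) :=
  {f | D.IsMLMap f}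

end PairSetup

end MLPair

/-! The extension step depends on how the new element b sits over `A` and the finite domain B of the
map; only the family's own conditions have to be kept.

If b is in `A` and algebraic over B, the complete types of B and of its part in `A` form a
Mordell-Lang challenge. For each pair of formulas from the two types of b it yields a common
solution in `A` on the other side. All these solutions lie in one finite set, so a single element of
`A` realizes both types (`exists_sameTypeOver_of_mem_acl`).

If b is in `A` but not algebraic over B, density realizes both transported types at once. They are
compatible because b realizes both and 𝓐 is an `L`-substructure of 𝓑.

If b is in acl(`A` ∪ B) but not in `A`, finitely many elements of `A` are added first, so that b
becomes algebraic over the domain. Its image must avoid `A`, so the members of `A` among the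
finitely many candidates are first put into the range: the map is injective and respects `A`, so
they are no longer available (`exists_extends_of_mem_acl`).

If b is outside acl(`A` ∪ B), codensity gives an image.

In each case the pregeometry keeps the domain and range independent from `A`; the three
`clIndep_insert` lemmas do this. The family is closed under inverses, so back follows from forth.
Quantifier-free formulas are preserved because terms of `L2` are terms of `Lβ` and the relations
outside `Lβ` live on `A`, where an extension of the map is `Lα`-elementary. Elementarity is then the
usual induction on formulas. -/

namespace MLPair

/-! ### Independence in pregeometries -/

/-- Every dependence over `Y ∪ Z` among elements of `X` is a dependence over `Z`. -/
def ClIndep {M : Type w} (cl : Set M → Set M) (X Y Z : Set M) : Prop :=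
  ∀ X' ⊆ X, ∀ x ∈ X, x ∈ cl (Y ∪ Z ∪ X') → x ∈ cl (Z ∪ X')

namespace IsPregeometry

variable {M : Type w} {cl : Set M → Set M}

theorem mem_cl (h : IsPregeometry cl) {X : Set M} {x : M} (hx : x ∈ X) : x ∈ cl X :=
  h.subset_cl X hx

theorem cl_le (h : IsPregeometry cl) {X Y : Set M} (hXY : X ⊆ cl Y) : cl X ⊆ cl Y :=
  (h.mono _ _ hXY).trans (h.idem Y)

/-- Adding an element of `Y` to `X` and to `Z`. -/
theorem clIndep_insert_of_mem (h : IsPregeometry cl) {X Y Z : Set M} (hi : ClIndep cl X Y Z)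
    {a : M} (ha : a ∈ Y) : ClIndep cl (insert a X) Y (insert a Z) := by
  intro X' hX' x hx hxcl
  rcases eq_or_ne x a with rfl | hne
  · exact h.mem_cl (by simp)
  have hxX : x ∈ X := hx.resolve_left hne
  -- The only possible element of X' outside X is a, which already belongs to Y.
  have h1 : x ∈ cl (Y ∪ Z ∪ (X' ∩ X)) := by
    refine h.mono _ _ ?_ hxcl
    intro y hy
    rcases hy with (hy | rfl | hy) | hy
    · exact Or.inl (Or.inl hy)
    · exact Or.inl (Or.inl ha)
    · exact Or.inl (Or.inr hy)
    · rcases hX' hy with rfl | hyX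
      · exact Or.inl (Or.inl ha)
      · exact Or.inr ⟨hy, hyX⟩
  exact h.mono _ _ (union_subset_union (subset_insert _ _) inter_subset_left)
    (hi _ inter_subset_right x hxX h1)

/-- The elements of B can be discarded one at a time. If e were indispensable, exchange would put e
in the closure of b and the rest, hence of Y and the rest; independence would then drop Y and make e
redundant after all. -/
theorem mem_cl_of_clIndep (h : IsPregeometry cl) {X Y Z : Set M} (hi : ClIndep cl X Y Z)
    {X' : Set M} (hX' : X' ⊆ X) {b : M} (hb : b ∈ cl (Y ∪ Z ∪ X')) {B : Set M} (hB : B.Finite) :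
    B ⊆ X → b ∈ cl (Z ∪ X' ∪ B) → b ∈ cl (Z ∪ X') := by
  induction B, hB using Set.Finite.induction_on with
  | empty => simp
  | @insert e B _ _ ih =>
    intro hBX hbcl
    rw [insert_subset_iff] at hBX
    refine ih hBX.2 ?_
    by_contra hcon
    rw [union_insert] at hbcl
    have h1 := h.exchange _ _ _ hbcl hcon
    have h2 : e ∈ cl (Y ∪ Z ∪ (X' ∪ B)) := by
      refine h.cl_le ?_ h1
      rintro y (rfl | (hy | hy) | hy)
      · exact h.mono _ _ (union_subset_union_right _ subset_union_left) hb
      · exact h.mem_cl (Or.inl (Or.inr hy))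
      · exact h.mem_cl (Or.inr (Or.inl hy))
      · exact h.mem_cl (Or.inr (Or.inr hy))
    have h3 := hi _ (union_subset hX' hBX.2) e hBX.1 h2
    rw [← union_assoc] at h3
    refine hcon (h.cl_le ?_ hbcl)
    rintro y (rfl | hy)
    · exact h3
    · exact h.mem_cl hy

/-- Adding an element of the closure of `X` to `X`. -/
theorem clIndep_insert_of_mem_cl (h : IsPregeometry cl) {X Y Z : Set M} (hX : X.Finite)
    (hi : ClIndep cl X Y Z) {b : M} (hb : b ∈ cl X) : ClIndep cl (insert b X) Y Z := by
  have hQ : ∀ X' ⊆ X, b ∈ cl (Y ∪ Z ∪ X') → b ∈ cl (Z ∪ X') := fun X' hX' hbX' =>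
    h.mem_cl_of_clIndep hi hX' hbX' hX subset_rfl (h.mono _ _ subset_union_right hb)
  intro X' hX' x hx hxcl
  by_cases hbX' : b ∈ X'
  · rcases eq_or_ne x b with rfl | hne
    · exact h.mem_cl (Or.inr hbX')
    have hxX : x ∈ X := hx.resolve_left hne
    have hX'' : X' \ {b} ⊆ X := fun y hy => (hX' hy.1).resolve_left hy.2
    have hins : insert b (X' \ {b}) = X' := by simp [insert_eq_of_mem hbX']
    rw [← hins, union_insert] at hxcl ⊢
    by_cases hx1 : x ∈ cl (Y ∪ Z ∪ (X' \ {b}))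
    · exact h.mono _ _ (subset_insert _ _) (hi _ hX'' x hxX hx1)
    by_cases hb1 : b ∈ cl (Y ∪ Z ∪ (X' \ {b}))
    · refine absurd (h.cl_le ?_ hxcl) hx1
      rintro y (rfl | hy)
      · exact hb1
      · exact h.mem_cl hy
    -- Neither x nor b depends on the remaining elements over Y ∪ Z. Trade x for b by exchange, drop
    -- Y by `hQ`, and exchange back.
    have h1 := h.exchange _ _ _ hxcl hx1
    rw [← union_insert] at h1
    have h2 := hQ _ (insert_subset hxX hX'') h1
    rw [union_insert] at h2
    refine h.exchange _ _ _ h2 fun hb2 => hb1 (h.mono _ _ ?_ hb2)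
    exact union_subset_union_left _ subset_union_right
  · have hX'' : X' ⊆ X := fun y hy =>
      (hX' hy).resolve_left (by rintro rfl; exact hbX' hy)
    rcases hx with rfl | hx
    · exact hQ _ hX'' hxcl
    · exact hi _ hX'' x hx hxcl

/-- Adding an element outside of the closure of `Y ∪ Z ∪ X` to `X`. -/
theorem clIndep_insert_of_notMem_cl (h : IsPregeometry cl) {X Y Z : Set M}
    (hi : ClIndep cl X Y Z) {b : M} (hb : b ∉ cl (Y ∪ Z ∪ X)) : ClIndep cl (insert b X) Y Z := by
  intro X' hX' x hx hxcl
  by_cases hbX' : b ∈ X'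
  · rcases eq_or_ne x b with rfl | hne
    · exact h.mem_cl (Or.inr hbX')
    have hxX : x ∈ X := hx.resolve_left hne
    have hX'' : X' \ {b} ⊆ X := fun y hy => (hX' hy.1).resolve_left hy.2
    have hins : insert b (X' \ {b}) = X' := by simp [insert_eq_of_mem hbX']
    rw [← hins, union_insert] at hxcl ⊢
    by_cases hx1 : x ∈ cl (Y ∪ Z ∪ (X' \ {b}))
    · exact h.mono _ _ (subset_insert _ _) (hi _ hX'' x hxX hx1)
    -- A dependence of x that really uses b would, by exchange, put b in the closure of Y ∪ Z ∪ X.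
    have h1 := h.exchange _ _ _ hxcl hx1
    rw [← union_insert] at h1
    exact absurd (h.mono _ _ (union_subset_union_right _ (insert_subset hxX hX'')) h1) hb
  · have hX'' : X' ⊆ X := fun y hy =>
      (hX' hy).resolve_left (by rintro rfl; exact hbX' hy)
    rcases hx with rfl | hx
    · exact absurd (h.mono _ _ (union_subset_union_right _ hX'') hxcl) hb
    · exact hi _ hX'' x hx hxcl

end IsPregeometry

/-! ### Agreement of the two notions of independence -/

section IndepSets

variable {L : FirstOrder.Language.{u, v}} {M : Type w} [L.Structure M]

theorem AclIndepOver.insert (h : IsPregeometry (acl L : Set M → Set M)) {X Z : Set M} {x : M}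
    (hX : AclIndepOver L X Z) (hx : x ∉ acl L (Z ∪ X)) : AclIndepOver L (insert x X) Z := by
  intro y hy hycl
  rcases eq_or_ne y x with rfl | hne
  · exact hx (h.mono _ _ (union_subset_union_right _ (by simp)) hycl)
  have hyX : y ∈ X := hy.resolve_left hne
  rw [insert_sdiff_of_notMem _ (by simpa using hne.symm), union_insert] at hycl
  refine hx (h.mono _ _ ?_ (h.exchange _ _ _ hycl (hX y hyX)))
  exact insert_subset (Or.inr hyX) (union_subset_union_right _ sdiff_subset)

/-- A basis is built greedily: an element is added exactly when it is not yet spanned. -/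
theorem exists_aclIndepOver_subset (h : IsPregeometry (acl L : Set M → Set M)) {X : Set M}
    (hX : X.Finite) (Z : Set M) :
    ∃ X₀ ⊆ X, AclIndepOver L X₀ Z ∧ X ⊆ acl L (Z ∪ X₀) := by
  induction X, hX using Set.Finite.induction_on with
  | empty => exact ⟨∅, subset_rfl, by simp [AclIndepOver], by simp⟩
  | @insert x X _ _ ih =>
    obtain ⟨X₀, hX₀, hind, hsp⟩ := ih
    by_cases hx : x ∈ acl L (Z ∪ X₀)
    · exact ⟨X₀, hX₀.trans (subset_insert _ _), hind, insert_subset hx hsp⟩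
    · refine ⟨insert x X₀, insert_subset_insert hX₀, hind.insert h hx, insert_subset ?_ ?_⟩
      · exact h.mem_cl (by simp)
      · exact hsp.trans (h.mono _ _ (union_subset_union_right _ (subset_insert _ _)))

/-- If x depends on X' over Y ∪ Z but not over Z, adjoining x to a basis of X' over Z gives a set
that is independent over Z but not over Y ∪ Z. The form without independent subsets is easier to
extend by one element. -/
theorem indepSets_iff_clIndep (h : IsPregeometry (acl L : Set M → Set M)) {X Y Z : Set M}
    (hX : X.Finite) : IndepSets L X Y Z ↔ ClIndep (acl L) X Y Z := by
  constructor
  · intro hi X' hX' x hx hxcl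
    by_contra hcon
    obtain ⟨X₀, hX₀, hind, hsp⟩ := exists_aclIndepOver_subset h (hX.subset hX') Z
    have hx₀ : x ∉ acl L (Z ∪ X₀) := fun hx₀ =>
      hcon (h.mono _ _ (union_subset_union_right _ hX₀) hx₀)
    have hxX₀ : x ∉ X₀ := fun hm => hx₀ (h.mem_cl (Or.inr hm))
    have h1 := hi _ (insert_subset hx (hX₀.trans hX')) (hind.insert h hx₀) x (mem_insert _ _)
    rw [insert_sdiff_self_of_notMem hxX₀] at h1
    refine h1 (h.cl_le ?_ hxcl)
    rintro y (hy | hy)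
    · exact h.mem_cl (Or.inl hy)
    · exact h.mono _ _ (union_subset_union_left _ subset_union_right) (hsp hy)
  · intro hi X₀ hX₀ hind x hx hxcl
    exact hind x hx (hi _ (sdiff_subset.trans hX₀) x (hX₀ hx) hxcl)

end IndepSets

end MLPair

namespace MLPair

/-! ### Tuples with the same type -/

section SameType

variable (L : FirstOrder.Language.{u, v}) {M N : Type w} [L.Structure M] [L.Structure N]

/-- The tuples `c` and `c'` satisfy the same formulas. -/
def SameType {γ : Type*} (c : γ → M) (c' : γ → N) : Prop :=
  ∀ φ : L.Formula γ, φ.Realize c ↔ φ.Realize c'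

/-- The set of formulas `φ(x, y)` satisfied by the tuple `(c, b)`. -/
def typeSet {γ : Type*} (c : γ → M) (b : M) : Set (L.Formula (γ ⊕ Unit)) :=
  {φ | φ.Realize (Sum.elim c fun _ => b)}

variable {L}

/-- Compactness inside a finite set: if every element failed some condition, directedness would
merge these conditions into one that all elements fail. It is applied to formulas directed by
conjunction and realizes algebraic types without saturation. -/
theorem exists_forall_of_finite {X J : Type*} [Nonempty J] {F : Set X} (hF : F.Finite)
    {P : J → X → Prop} (hdir : ∀ i j, ∃ k, ∀ a, P k a → P i a ∧ P j a)
    (h : ∀ j, ∃ a ∈ F, P j a) : ∃ a ∈ F, ∀ j, P j a := by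
  by_contra! hcon
  have key : ∀ G ⊆ F, ∃ j, ∀ a ∈ G, ¬ P j a := by
    intro G hG
    induction G, hF.subset hG using Set.Finite.induction_on with
    | empty => exact ⟨Classical.arbitrary J, by simp⟩
    | @insert a G _ _ ih =>
      obtain ⟨ha, hG⟩ := insert_subset_iff.1 hG
      obtain ⟨i, hi⟩ := ih hG
      obtain ⟨j, hj⟩ := hcon a ha
      obtain ⟨k, hk⟩ := hdir i j
      refine ⟨k, ?_⟩
      rintro x (rfl | hx) hkx
      · exact hj (hk x hkx).2
      · exact hi x hx (hk x hkx).1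
  obtain ⟨j, hj⟩ := key F subset_rfl
  obtain ⟨a, haF, ha⟩ := h j
  exact hj a haF ha

theorem mem_solutions {γ : Type*} {φ : L.Formula (γ ⊕ Unit)} {c : γ → M} {y : M} :
    y ∈ solutions L φ c ↔ φ.Realize (Sum.elim c fun _ => y) :=
  Iff.rfl

/-- The formula that says that `φ(x, y)` has at most `k` solutions `y`. -/
noncomputable def atMost {γ : Type*} (k : ℕ) (φ : L.Formula (γ ⊕ Unit)) : L.Formula γ :=
  Formula.iExs (Fin k) <| Formula.iAlls Unit (α := γ ⊕ Fin k) <|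
    (φ.relabel (Sum.map Sum.inl id)).imp <|
      Formula.iSup fun i : Fin k =>
        (Term.var (Sum.inl (Sum.inr i))).equal (Term.var (Sum.inr ()))

theorem realize_atMost {γ : Type*} {k : ℕ} {φ : L.Formula (γ ⊕ Unit)} {c : γ → M} :
    (atMost k φ).Realize c ↔ ∃ y : Fin k → M, ∀ z ∈ solutions L φ c, ∃ i, y i = z := by
  simp only [atMost, Formula.realize_iExs, Formula.realize_iAlls, Formula.realize_imp,
    Formula.realize_relabel, Formula.realize_iSup, Formula.realize_equal, Term.realize_var,
    Sum.elim_inl, Sum.elim_inr]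
  refine exists_congr fun y => ⟨fun h z hz => ?_, fun h z hz => ?_⟩
  · refine h (fun _ => z) ?_
    rw [mem_solutions] at hz
    convert hz using 1
    ext (i | i) <;> rfl
  · refine h (z ()) ?_
    rw [mem_solutions]
    convert hz using 1
    ext (i | i) <;> rfl

/-- Finiteness is an infinite disjunction of first-order conditions on c, hence depends only on the
type of c. -/
theorem finite_solutions_iff {γ : Type*} {φ : L.Formula (γ ⊕ Unit)} {c : γ → M} :
    (solutions L φ c).Finite ↔ ∃ k, (atMost k φ).Realize c := by
  simp only [realize_atMost]
  constructor
  · intro h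
    obtain ⟨n, e, he⟩ := h.fin_param
    exact ⟨n, e, fun z hz => by rw [← he.2] at hz; exact hz⟩
  · rintro ⟨k, y, hy⟩
    exact (finite_range y).subset fun z hz => hy z hz

namespace SameType

variable {γ δ : Type*} {c : γ → M} {c' : γ → N}

theorem symm (h : SameType L c c') : SameType L c' c := fun φ => (h φ).symm

theorem comp (h : SameType L c c') (g : δ → γ) : SameType L (c ∘ g) (c' ∘ g) := fun φ => by
  simpa only [Formula.realize_relabel] using h (φ.relabel g)

theorem eq_iff (h : SameType L c c') (i j : γ) : c i = c j ↔ c' i = c' j := by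
  simpa using h ((Term.var i).equal (Term.var j))

/-- Both tuples arise from the given ones by the same reindexing. This switches between tuples
indexed by a graph, a range or `Fin n`. -/
theorem of_forall_exists {d : δ → M} {d' : δ → N} (h : SameType L c c')
    (hd : ∀ j, ∃ i, c i = d j ∧ c' i = d' j) : SameType L d d' := by
  choose g hg using hd
  convert h.comp g using 1
  · exact funext fun j => (hg j).1.symm
  · exact funext fun j => (hg j).2.symm

theorem of_imp (h : ∀ φ : L.Formula γ, φ.Realize c → φ.Realize c') : SameType L c c' :=
  fun φ => ⟨h φ, fun hφ => by_contra fun hn => (h φ.not hn) hφ⟩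

theorem finite_solutions_iff (h : SameType L c c') (φ : L.Formula (γ ⊕ Unit)) :
    (solutions L φ c).Finite ↔ (solutions L φ c').Finite := by
  rw [MLPair.finite_solutions_iff, MLPair.finite_solutions_iff]
  exact exists_congr fun k => h _

theorem nonempty_solutions (h : SameType L c c') {φ : L.Formula (γ ⊕ Unit)}
    (hφ : (solutions L φ c).Nonempty) : (solutions L φ c').Nonempty := by
  obtain ⟨z, hz⟩ := hφ
  obtain ⟨y, hy⟩ := Formula.realize_iExs.1 <|
    (h (φ.iExs Unit)).1 (Formula.realize_iExs.2 ⟨fun _ => z, hz⟩)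
  exact ⟨y (), hy⟩

theorem exists_of_finite (h : SameType L c c') {b : M} {q : Set (L.Formula (γ ⊕ Unit))}
    (hq : q ⊆ typeSet L c b) (hfin : q.Finite) : ∃ y, ∀ φ ∈ q, y ∈ solutions L φ c' := by
  have := hfin.to_subtype
  obtain ⟨y, hy⟩ := h.nonempty_solutions (φ := Formula.iInf fun φ : q => φ.1)
    ⟨b, Formula.realize_iInf.2 fun φ => hq φ.2⟩
  exact ⟨y, fun φ hφ => Formula.realize_iInf.1 hy ⟨φ, hφ⟩⟩

/-- Each formula of the type of b is consistent with φ, so it holds at one of the finitely many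
solutions of φ over c'; by `exists_forall_of_finite` one solution serves all formulas. -/
theorem exists_of_finite_solutions (h : SameType L c c') {b : M} {φ : L.Formula (γ ⊕ Unit)}
    (hb : b ∈ solutions L φ c) (hfin : (solutions L φ c).Finite) :
    ∃ b' : N, SameType L (Sum.elim c fun _ : Unit => b) (Sum.elim c' fun _ : Unit => b') := by
  have : Nonempty (typeSet L c b) := ⟨⟨φ, hb⟩⟩
  obtain ⟨b', -, hb'⟩ := exists_forall_of_finite (J := typeSet L c b)
    (P := fun φ y => y ∈ solutions L φ.1 c') ((h.finite_solutions_iff φ).1 hfin)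
    (fun ψ χ => ⟨⟨ψ.1 ⊓ χ.1, Formula.realize_inf.2 ⟨ψ.2, χ.2⟩⟩,
      fun a ha => Formula.realize_inf.1 ha⟩)
    (fun ψ => by
      obtain ⟨y, hy⟩ := h.nonempty_solutions (φ := φ ⊓ ψ.1) ⟨b, Formula.realize_inf.2 ⟨hb, ψ.2⟩⟩
      exact ⟨y, Formula.realize_inf.1 hy⟩)
  exact ⟨b', of_imp fun φ hφ => hb' ⟨φ, hφ⟩⟩

end SameType

theorem mem_acl_range_iff {γ : Type*} {c : γ → M} {y : M} :
    y ∈ acl L (range c) ↔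
      ∃ φ : L.Formula (γ ⊕ Unit), y ∈ solutions L φ c ∧ (solutions L φ c).Finite := by
  constructor
  · rintro ⟨s, hs, hfin, hy⟩
    obtain ⟨φ, hφ⟩ := definable_iff_exists_formula_sum.1 hs
    -- Each parameter gets an index at which c takes it as value; c need not be injective.
    choose g hg using fun x : range c => x.2
    have hsol : solutions L (φ.relabel (Sum.map g fun _ : Fin 1 => ())) c = s := by
      ext z
      have hz : z ∈ s ↔ (fun _ : Fin 1 => z) ∈ {x : Fin 1 → M | x 0 ∈ s} := Iff.rfl
      rw [hz, hφ]
      simp only [mem_solutions, mem_ofPred_eq, Formula.realize_relabel]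
      rw [iff_iff_eq]
      congr 1
      ext (i | i)
      · exact hg i
      · rfl
    exact ⟨_, hsol ▸ hy, hsol ▸ hfin⟩
  · rintro ⟨φ, hy, hfin⟩
    refine ⟨_, definable_iff_exists_formula_sum.2
      ⟨φ.relabel (Sum.map (rangeFactorization c) fun _ => 0), ?_⟩, hfin, hy⟩
    ext z
    simp only [mem_solutions, mem_ofPred_eq, Formula.realize_relabel]
    rw [iff_iff_eq]
    congr 1
    ext (i | i) <;> rfl

/-- The type of `b` over `c`, moved to `c'`, is a type over the range of `c'`. -/
theorem SameType.isTypeOver {C : Set N} {c : C → M} (h : SameType L c ((↑) : C → N)) (b : M) :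
    IsTypeOver L (typeSet L c b) := by
  refine ⟨fun q₀ hq₀ hfin => h.exists_of_finite hq₀ hfin, fun φ => ?_⟩
  by_cases hφ : φ ∈ typeSet L c b
  · exact Or.inl hφ
  · exact Or.inr hφ

/-- A formula with finitely many solutions on the side of C would also have finitely many over c,
and would witness that b is algebraic. -/
theorem SameType.nonAlgebraic {C : Set N} {c : C → M} (h : SameType L c ((↑) : C → N)) {b : M}
    (hb : b ∉ acl L (range c)) : NonAlgebraic L (typeSet L c b) := by
  intro φ hφ hfin
  exact hb (mem_acl_range_iff.2 ⟨φ, hφ, (h.finite_solutions_iff φ).2 hfin⟩)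

end SameType

/-! ### Partial maps -/

namespace PartialMap

variable {M N : Type w}

theorem Extends.trans {f g h : PartialMap M N} (h₁ : h.Extends g) (h₂ : g.Extends f) :
    h.Extends f :=
  Subset.trans h₂ h₁

theorem Extends.dom_subset {f g : PartialMap M N} (h : g.Extends f) : f.dom ⊆ g.dom :=
  fun _ ⟨b, hb⟩ => ⟨b, h hb⟩

/-- The inverse of an injective partial map. -/
def inverse (f : PartialMap M N) (hf : ∀ ⦃a a' b⦄, (a, b) ∈ f.graph → (a', b) ∈ f.graph → a = a') :
    PartialMap N M where
  graph := {p | (p.2, p.1) ∈ f.graph}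
  functional _ _ _ h h' := hf h h'

theorem range_fst (f : PartialMap M N) : range (fun p : f.graph => p.1.1) = f.dom := by
  ext x
  exact ⟨fun ⟨⟨⟨a, b⟩, hp⟩, h⟩ => ⟨b, h ▸ hp⟩, fun ⟨b, hb⟩ => ⟨⟨(x, b), hb⟩, rfl⟩⟩

theorem range_snd (f : PartialMap M N) : range (fun p : f.graph => p.1.2) = f.ran := by
  ext x
  exact ⟨fun ⟨⟨⟨a, b⟩, hp⟩, h⟩ => ⟨a, h ▸ hp⟩, fun ⟨b, hb⟩ => ⟨⟨(b, x), hb⟩, rfl⟩⟩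

/-- Iterated extension to the elements of a finite set. -/
theorem exists_extends_of_finite {I : Set (PartialMap M N)} {P : M → Prop}
    (h : ∀ f ∈ I, ∀ a, P a → ∃ g ∈ I, g.Extends f ∧ a ∈ g.dom) {X : Set M} (hX : X.Finite)
    (hXP : ∀ a ∈ X, P a) {f : PartialMap M N} (hf : f ∈ I) :
    ∃ g ∈ I, g.Extends f ∧ X ⊆ g.dom := by
  induction X, hX using Set.Finite.induction_on with
  | empty => exact ⟨f, hf, subset_rfl, by simp⟩
  | @insert a X _ _ ih =>
    obtain ⟨g, hg, hgf, hXg⟩ := ih fun x hx => hXP x (mem_insert_of_mem _ hx)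
    obtain ⟨k, hk, hkg, hak⟩ := h g hg a (hXP a (mem_insert _ _))
    exact ⟨k, hk, hkg.trans hgf, insert_subset hak (hXg.trans hkg.dom_subset)⟩

/-- The partial map `f ∪ {(a, b)}`. -/
def insert (f : PartialMap M N) (a : M) (b : N) (h : ∀ b', (a, b') ∈ f.graph → b' = b) :
    PartialMap M N where
  graph := Insert.insert (a, b) f.graph
  functional := by
    rintro x y y' (hy | hy) (hy' | hy')
    · exact (Prod.ext_iff.1 hy).2.trans (Prod.ext_iff.1 hy').2.symm
    · obtain ⟨rfl, rfl⟩ := Prod.ext_iff.1 hy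
      exact (h _ hy').symm
    · obtain ⟨rfl, rfl⟩ := Prod.ext_iff.1 hy'
      exact h _ hy
    · exact f.functional hy hy'

theorem mem_graph_insert {f : PartialMap M N} {a : M} {b : N}
    {h : ∀ b', (a, b') ∈ f.graph → b' = b} {x : M} {y : N} :
    (x, y) ∈ (f.insert a b h).graph ↔ (x = a ∧ y = b) ∨ (x, y) ∈ f.graph :=
  or_congr Prod.ext_iff Iff.rfl

theorem dom_insert {f : PartialMap M N} {a : M} {b : N}
    {h : ∀ b', (a, b') ∈ f.graph → b' = b} : (f.insert a b h).dom = Insert.insert a f.dom := by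
  ext x
  constructor
  · rintro ⟨y, hy⟩
    exact (mem_graph_insert.1 hy).imp (·.1) fun hy => ⟨y, hy⟩
  · rintro (rfl | ⟨y, hy⟩)
    · exact ⟨b, mem_graph_insert.2 (Or.inl ⟨rfl, rfl⟩)⟩
    · exact ⟨y, mem_graph_insert.2 (Or.inr hy)⟩

theorem ran_insert {f : PartialMap M N} {a : M} {b : N}
    {h : ∀ b', (a, b') ∈ f.graph → b' = b} : (f.insert a b h).ran = Insert.insert b f.ran := by
  ext y
  constructor
  · rintro ⟨x, hx⟩
    exact (mem_graph_insert.1 hx).imp (·.2) fun hx => ⟨x, hx⟩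
  · rintro (rfl | ⟨x, hx⟩)
    · exact ⟨a, mem_graph_insert.2 (Or.inl ⟨rfl, rfl⟩)⟩
    · exact ⟨x, mem_graph_insert.2 (Or.inr hx)⟩

/-- The inverse of an injective partial map as a tuple indexed by the range. -/
theorem exists_tuple_of_ran (f : PartialMap M N) :
    ∃ c : f.ran → M, (∀ y, (c y, (y : N)) ∈ f.graph) := by
  choose c hc using fun y : f.ran => y.2
  exact ⟨c, hc⟩

theorem range_tuple_subset {f : PartialMap M N} {c : f.ran → M} (hc : ∀ y, (c y, (y : N)) ∈ f.graph) :
    range c ⊆ f.dom := by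
  rintro _ ⟨y, rfl⟩
  exact ⟨y, hc y⟩

/-! ### Elementary maps and back-and-forth systems -/

variable {L : FirstOrder.Language.{u, v}} [L.Structure M] [L.Structure N]

theorem IsElementary.sameType {f : PartialMap M N} (hf : f.IsElementary L) {γ : Type*} {c : γ → M}
    {c' : γ → N} (h : ∀ i, (c i, c' i) ∈ f.graph) : SameType L c c' :=
  SameType.comp (c := fun p : f.graph => p.1.1) (c' := fun p => p.1.2) hf fun i => ⟨_, h i⟩

theorem IsElementary.injective {f : PartialMap M N} (hf : f.IsElementary L) ⦃a a' : M⦄ ⦃b : N⦄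
    (h : (a, b) ∈ f.graph) (h' : (a', b) ∈ f.graph) : a = a' :=
  (SameType.eq_iff (L := L) hf ⟨_, h⟩ ⟨_, h'⟩).2 rfl

theorem IsElementary.inverse {f : PartialMap M N} (hf : f.IsElementary L)
    (hinj : ∀ ⦃a a' b⦄, (a, b) ∈ f.graph → (a', b) ∈ f.graph → a = a') :
    (f.inverse hinj).IsElementary L :=
  (hf.sameType (c := fun p : (f.inverse hinj).graph => p.1.2) (c' := fun p => p.1.1)
    fun p => p.2).symm

/-- Induction on φ for all maps of the system at once: at a quantifier the map is replaced by an
extension containing the new element. -/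
theorem IsBackAndForthSystem.realize_iff {I : Set (PartialMap M N)}
    (hI : IsBackAndForthSystem L I) {γ : Type*} {n : ℕ} (φ : L.BoundedFormula γ n) {v : γ → M}
    {v' : γ → N} {f : PartialMap M N} (hf : f ∈ I) (hv : ∀ i, (v i, v' i) ∈ f.graph)
    {xs : Fin n → M} {xs' : Fin n → N} (hxs : ∀ i, (xs i, xs' i) ∈ f.graph) :
    φ.Realize v xs ↔ φ.Realize v' xs' := by
  induction φ generalizing f with
  | falsum => rfl
  | @equal n t₁ t₂ =>
    let g : γ ⊕ Fin n → f.graph := Sum.elim (fun i => ⟨_, hv i⟩) fun i => ⟨_, hxs i⟩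
    have h := hI.partialIso f hf ((t₁.relabel g).equal (t₂.relabel g))
      (BoundedFormula.IsAtomic.equal _ _).isQF
    have e₁ : (fun p : f.graph => p.1.1) ∘ g = Sum.elim v xs := by ext (i | i) <;> rfl
    have e₂ : (fun p : f.graph => p.1.2) ∘ g = Sum.elim v' xs' := by ext (i | i) <;> rfl
    rwa [Formula.realize_equal, Formula.realize_equal, Term.realize_relabel,
      Term.realize_relabel, Term.realize_relabel, Term.realize_relabel, e₁, e₂] at h
  | @rel n l R ts =>
    let g : γ ⊕ Fin n → f.graph := Sum.elim (fun i => ⟨_, hv i⟩) fun i => ⟨_, hxs i⟩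
    have h := hI.partialIso f hf (R.formula fun i => (ts i).relabel g)
      (BoundedFormula.IsAtomic.rel _ _).isQF
    have e₁ : (fun p : f.graph => p.1.1) ∘ g = Sum.elim v xs := by ext (i | i) <;> rfl
    have e₂ : (fun p : f.graph => p.1.2) ∘ g = Sum.elim v' xs' := by ext (i | i) <;> rfl
    simp only [Formula.realize_rel, Term.realize_relabel, e₁, e₂] at h
    exact h
  | imp φ ψ ihφ ihψ => exact imp_congr (ihφ hf hv hxs) (ihψ hf hv hxs)
  | all φ ih =>
    simp only [BoundedFormula.realize_all]
    constructor
    · intro h b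
      obtain ⟨g, hg, hgf, a, hab⟩ := hI.back f hf b
      refine (ih hg (fun i => hgf (hv i)) fun i => ?_).1 (h a)
      induction i using Fin.lastCases with
      | last => simpa using hab
      | cast i => simpa using hgf (hxs i)
    · intro h a
      obtain ⟨g, hg, hgf, b, hab⟩ := hI.forth f hf a
      refine (ih hg (fun i => hgf (hv i)) fun i => ?_).2 (h b)
      induction i using Fin.lastCases with
      | last => simpa using hab
      | cast i => simpa using hgf (hxs i)

theorem IsBackAndForthSystem.isElementary {I : Set (PartialMap M N)}
    (hI : IsBackAndForthSystem L I) {f : PartialMap M N} (hf : f ∈ I) : f.IsElementary L :=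
  fun φ => hI.realize_iff φ hf (fun p => p.2) fun i => i.elim0

end PartialMap

end MLPair

namespace MLPair

namespace PairSetup

variable {S : FirstOrder.Language.{u, v}} {D : PairSetup S} {M N : Type w} [D.L2.Structure M]
  [D.L2.Structure N]

/-! ### Models of `T2` -/

instance isExpansionOn_inclα : D.inclα.IsExpansionOn M := D.inclα.isExpansionOn_reduct M

instance isExpansionOn_inclβ : D.inclβ.IsExpansionOn M := D.inclβ.isExpansionOn_reduct M

theorem modelsTβ [hM : M ⊨ D.T2] : M ⊨ D.Tβ :=
  (D.inclβ.onTheory_model D.Tβ).1 <|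
    hM.mono fun _ h => Or.inl (Or.inl (Or.inl h))

theorem realize_formA {γ : Type*} {n : ℕ} {t : D.L2.Term (γ ⊕ Fin n)} {v : γ → M} {xs : Fin n → M} :
    (D.formA t).Realize v xs ↔ t.realize (Sum.elim v xs) ∈ D.setA M :=
  BoundedFormula.realize_rel₁

/-- Bounded quantifiers range exactly over the universe of 𝓐, and terms have the same values there
because `A` is closed under the functions of `Lα`. -/
theorem realize_relativize [M ⊨ D.T2] {γ : Type*} {n : ℕ} (φ : D.Lα.BoundedFormula γ n)
    (v : γ → D.partA M) (xs : Fin n → D.partA M) :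
    (D.relativize φ).Realize (fun i => (v i : M)) (fun i => (xs i : M)) ↔ φ.Realize v xs := by
  have hterm : ∀ {n : ℕ} (xs : Fin n → D.partA M) (t : D.Lα.Term (γ ⊕ Fin n)),
      (D.inclα.onTerm t).realize (Sum.elim (fun i => (v i : M)) fun i => (xs i : M)) =
        ((t.realize (Sum.elim v xs) : D.partA M) : M) := by
    intro n xs t
    have e : (Sum.elim (fun i => (v i : M)) fun i => (xs i : M)) =
        (D.partA M).subtype ∘ Sum.elim v xs := by
      ext (i | i) <;> rfl
    rw [LHom.realize_onTerm, e, HomClass.realize_term]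
    rfl
  induction φ with
  | falsum => rfl
  | equal t₁ t₂ =>
    change (D.inclα.onTerm t₁).realize _ = (D.inclα.onTerm t₂).realize _ ↔ _
    rw [hterm, hterm]
    exact Subtype.ext_iff.symm
  | rel R ts =>
    change Structure.RelMap (D.inclα.onRelation R) (fun i => (D.inclα.onTerm (ts i)).realize _) ↔ _
    simp only [hterm]
    rfl
  | imp φ ψ ihφ ihψ => exact imp_congr (ihφ xs) (ihψ xs)
  | @all n φ ih =>
    have e : ∀ x : D.partA M, (Fin.snoc (fun i => (xs i : M)) (x : M) : Fin (n + 1) → M) =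
        fun i => ((Fin.snoc xs x : Fin (n + 1) → D.partA M) i : M) := by
      intro x
      ext i
      induction i using Fin.lastCases <;> simp
    change (∀ x : M, (D.formA _).Realize _ _ → (D.relativize φ).Realize _ _) ↔ ∀ x, φ.Realize _ _
    simp only [realize_formA, Term.realize_var, Sum.elim_inr, Fin.snoc_last]
    constructor
    · intro h x
      have := h x x.2
      rw [e] at this
      exact (ih _).1 this
    · intro h x hx
      have := (ih _).2 (h ⟨x, hx⟩)
      rwa [← e] at this

theorem realize_relativize_formula [M ⊨ D.T2] {γ : Type*} (φ : D.Lα.Formula γ)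
    (v : γ → D.partA M) :
    Formula.Realize (D.relativize φ) (fun i => (v i : M)) ↔ φ.Realize v := by
  rw [Formula.Realize, Formula.Realize, ← realize_relativize]
  simp only [iff_eq_eq]
  congr 1
  ext i
  exact i.elim0

theorem partA_realize [hM : M ⊨ D.T2] {φ : D.Lα.Sentence} (h : D.Tα ⊨ᵇ φ) : D.partA M ⊨ φ := by
  have h1 : M ⊨ (D.relativize φ : D.L2.Sentence) :=
    hM.realize_of_mem _ (Or.inl (Or.inl (Or.inr ⟨φ, h, rfl⟩)))
  refine (realize_relativize_formula φ default).1 ?_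
  rw [Subsingleton.elim (fun i => ((default : Empty → D.partA M) i : M)) default]
  exact h1

theorem modelsTα [M ⊨ D.T2] : D.partA M ⊨ D.Tα :=
  ⟨fun _ h => partA_realize (Theory.models_sentence_of_mem h)⟩

variable (D M) in
theorem nonempty_partA [M ⊨ D.T2] : Nonempty (D.partA M) := by
  -- Models are nonempty by convention, so `Tα` entails the negation of ∀x ⊥, and its relativization
  -- is an axiom of `T2`.
  have h : D.partA M ⊨ ((BoundedFormula.falsum.all).not : D.Lα.Sentence) :=
    partA_realize (Theory.models_sentence_iff.2 fun K hK => hK K.nonempty'.some)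
  by_contra hcon
  exact h fun x => hcon ⟨x⟩

variable (D M) in
theorem nonempty_of_models [M ⊨ D.T2] : Nonempty M := (nonempty_partA D M).map Subtype.val

theorem pregeometry (hβ : IsGeometric.{u, v, w} D.Tβ) [M ⊨ D.T2] :
    IsPregeometry (acl D.Lβ : Set M → Set M) :=
  have := nonempty_of_models D M
  have : M ⊨ D.Tβ := modelsTβ
  hβ.pregeometry M

/-- Quantifier-free formulas of the common language have the same meaning in `𝓐` and in `𝓑`. -/
theorem realize_inclLβ_iff_of_isQF [M ⊨ D.T2] {γ : Type*} {θ : D.L.Formula γ} (hθ : θ.IsQF)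
    (v : γ → D.partA M) :
    (D.inclLβ.onFormula θ).Realize (fun i => (v i : M)) ↔ (D.inclLα.onFormula θ).Realize v := by
  let : D.L.Structure M := D.inclLβ.reduct M
  let : D.L.Structure (D.partA M) := D.inclLα.reduct (D.partA M)
  have h₁ : D.inclLβ.IsExpansionOn M := D.inclLβ.isExpansionOn_reduct M
  have h₂ : D.inclLα.IsExpansionOn (D.partA M) := D.inclLα.isExpansionOn_reduct (D.partA M)
  let e : D.partA M ↪[D.L] M :=
    { toFun := (↑)
      inj' := Subtype.coe_injective
      map_fun' := fun _ _ => rfl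
      map_rel' := fun _ _ => Iff.rfl }
  rw [LHom.realize_onFormula, LHom.realize_onFormula]
  have := hθ.realize_embedding e (v := v) (xs := default)
  rw [Formula.Realize, Formula.Realize, ← this]
  simp only [iff_eq_eq]
  congr 1
  ext i
  exact i.elim0

/-- Every term of the language of pairs is a term of `Lβ`. -/
theorem exists_onTerm_eq {γ : Type*} (t : D.L2.Term γ) :
    ∃ t' : D.Lβ.Term γ, D.inclβ.onTerm t' = t := by
  induction t with
  | var i => exact ⟨Term.var i, rfl⟩
  | func F ts ih =>
    choose ts' hts' using ih
    rcases F with ⟨F, hF⟩ | F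
    · refine ⟨Term.func (⟨F, hF.elim (fun h => D.funs_subset _ h) id⟩ : D.β.funs _) ts', ?_⟩
      simp only [LHom.onTerm, hts']
      rfl
    · exact F.elim

theorem mem_setA_of_relMap [hM : M ⊨ D.T2] {n : ℕ} (R : D.Lα.Relations n) (hR : R.1 ∉ D.β.rels n)
    {x : Fin n → M} (hx : Structure.RelMap (D.inclα.onRelation R) x) (i : Fin n) :
    x i ∈ D.setA M := by
  have h : M ⊨ D.axiomT2 R := hM.realize_of_mem _ (Or.inr ⟨n, R, hR, rfl⟩)
  have h' := (BoundedFormula.realize_alls.1 h) x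
  simp only [BoundedFormula.realize_imp, BoundedFormula.realize_iInf] at h'
  exact realize_formA.1 (h' hx i)

theorem aleph0_le_of_cardT2_lt {κ : Cardinal.{w}}
    (hκ : Cardinal.lift.{w} D.cardT2 < Cardinal.lift.{max u v} κ) : Cardinal.aleph0 ≤ κ := by
  have h : Cardinal.aleph0 ≤ Cardinal.lift.{w} D.cardT2 :=
    Cardinal.aleph0_le_lift.2 (le_max_left _ _)
  exact Cardinal.aleph0_le_lift.1 (h.trans hκ.le)

theorem density_codensity_of_finite {T : D.L2.Theory} (hT : IsMLTheory.{u, v, w} D T) [N ⊨ D.T2] [N ⊨ T]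
    {κ : Cardinal.{w}} (hκ : Cardinal.lift.{w} D.cardT2 < Cardinal.lift.{max u v} κ)
    (hN : IsSaturated D.L2 N κ) {C : Set N} (hC : C.Finite) {c : C → M}
    (hc : SameType D.Lβ c ((↑) : C → N)) {b : M} (hb : b ∉ acl D.Lβ (range c)) :
    D.DensityFor N C (typeSet D.Lβ c b) ∧ D.CodensityFor N C (typeSet D.Lβ c b) :=
  hT.density_codensity κ hκ N hN C
    ((Cardinal.lt_aleph0_iff_set_finite.2 hC).trans_le (aleph0_le_of_cardT2_lt hκ)) _
    (hc.isTypeOver b) (hc.nonAlgebraic hb)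

end PairSetup

end MLPair

namespace MLPair

namespace PairSetup

variable {S : FirstOrder.Language.{u, v}} {D : PairSetup S} {M N : Type w} [D.L2.Structure M]
  [D.L2.Structure N] [M ⊨ D.T2] [N ⊨ D.T2]

/-! ### Inverses and one-point extensions of maps of the family -/

namespace IsMLMap

variable {f : PartialMap M N}

/-- The condition on images gives this pointwise form; the converse direction needs the injectivity
of elementary maps. -/
theorem mem_setA_iff (hf : D.IsMLMap f) {a : M} {b : N} (hab : (a, b) ∈ f.graph) :
    a ∈ D.setA M ↔ b ∈ D.setA N := by
  constructor
  · intro ha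
    have : b ∈ D.setA N ∩ f.ran := hf.image_A ▸ ⟨a, ⟨ha, b, hab⟩, hab⟩
    exact this.1
  · intro hb
    have : b ∈ f.image (D.setA M ∩ f.dom) := hf.image_A ▸ ⟨hb, a, hab⟩
    obtain ⟨a', ha', hab'⟩ := this
    rw [hf.elementary_β.injective hab hab']
    exact ha'.1

theorem finite_dom (hf : D.IsMLMap f) : f.dom.Finite := by
  have := hf.finite.to_subtype
  exact f.range_fst ▸ finite_range _

theorem finite_ran (hf : D.IsMLMap f) : f.ran.Finite := by
  have := hf.finite.to_subtype
  exact f.range_snd ▸ finite_range _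

/-- All conditions are symmetric in the two sides, which reduces every statement about ranges to one
about domains. -/
theorem inverse (hf : D.IsMLMap f) : D.IsMLMap (f.inverse hf.elementary_β.injective) where
  finite := hf.finite.preimage Prod.swap_injective.injOn
  elementary_β := hf.elementary_β.inverse _
  indep_dom := hf.indep_ran
  indep_ran := hf.indep_dom
  image_A := by
    ext a
    constructor
    · rintro ⟨b, ⟨hb, -⟩, hab⟩
      exact ⟨(hf.mem_setA_iff hab).2 hb, b, hab⟩
    · rintro ⟨ha, b, hab⟩
      exact ⟨b, ⟨(hf.mem_setA_iff hab).1 ha, a, hab⟩, hab⟩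
  elementary_α := hf.elementary_α.inverse hf.elementary_α.injective

theorem exists_insert (hf : D.IsMLMap f) (hβ : IsGeometric.{u, v, w} D.Tβ) {b : M} {b' : N}
    (hbb' : SameType D.Lβ (Sum.elim (fun p : f.graph => p.1.1) fun _ : Unit => b)
      (Sum.elim (fun p : f.graph => p.1.2) fun _ : Unit => b'))
    (hA : b ∈ D.setA M ↔ b' ∈ D.setA N)
    (hα : ∀ (hb : b ∈ D.partA M) (hb' : b' ∈ D.partA N), SameType D.Lα
      (Sum.elim (fun p : (f.restrict (D.partA M) (D.partA N)).graph => p.1.1)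
        fun _ : Unit => (⟨b, hb⟩ : D.partA M))
      (Sum.elim (fun p : (f.restrict (D.partA M) (D.partA N)).graph => p.1.2)
        fun _ : Unit => (⟨b', hb'⟩ : D.partA N)))
    (hi : ClIndep (acl D.Lβ) (insert b f.dom) (D.setA M) (D.setA M ∩ insert b f.dom))
    (hi' : ClIndep (acl D.Lβ) (insert b' f.ran) (D.setA N) (D.setA N ∩ insert b' f.ran)) :
    ∃ g ∈ D.mlMaps M N, g.Extends f ∧ (b, b') ∈ g.graph := by
  have hfun : ∀ d, (b, d) ∈ f.graph → d = b' := fun d hd =>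
    (hbb'.eq_iff (Sum.inl ⟨_, hd⟩) (Sum.inr ())).1 rfl
  refine ⟨f.insert b b' hfun, ⟨hf.finite.insert _, ?_, ?_, ?_, ?_, ?_⟩, subset_insert _ _,
    mem_insert _ _⟩
  · refine hbb'.of_forall_exists ?_
    rintro ⟨⟨x, y⟩, hxy⟩
    rcases PartialMap.mem_graph_insert.1 hxy with ⟨rfl, rfl⟩ | h
    · exact ⟨Sum.inr (), rfl, rfl⟩
    · exact ⟨Sum.inl ⟨_, h⟩, rfl, rfl⟩
  · rw [PartialMap.dom_insert]
    exact (indepSets_iff_clIndep (pregeometry hβ) (hf.finite_dom.insert _)).2 hi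
  · rw [PartialMap.ran_insert]
    exact (indepSets_iff_clIndep (pregeometry hβ) (hf.finite_ran.insert _)).2 hi'
  · have hmem : ∀ {x y}, (x, y) ∈ (f.insert b b' hfun).graph →
        (x ∈ D.setA M ↔ y ∈ D.setA N) := by
      intro x y hxy
      rcases PartialMap.mem_graph_insert.1 hxy with ⟨rfl, rfl⟩ | h
      · exact hA
      · exact hf.mem_setA_iff h
    ext y
    constructor
    · rintro ⟨x, ⟨hx, -⟩, hxy⟩
      exact ⟨(hmem hxy).1 hx, x, hxy⟩
    · rintro ⟨hy, x, hxy⟩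
      exact ⟨x, ⟨(hmem hxy).2 hy, y, hxy⟩, hxy⟩
  · by_cases hb : b ∈ D.setA M
    · refine (hα hb (hA.1 hb)).of_forall_exists ?_
      rintro ⟨⟨x, y⟩, hxy⟩
      rcases (PartialMap.mem_graph_insert (h := hfun)).1 hxy with ⟨hx, hy⟩ | h
      · exact ⟨Sum.inr (), Subtype.ext hx.symm, Subtype.ext hy.symm⟩
      · exact ⟨Sum.inl ⟨_, h⟩, rfl, rfl⟩
    -- With b outside `A`, the restriction to the `A`-parts gains no pair.
    · refine hf.elementary_α.sameType ?_
      rintro ⟨⟨x, y⟩, hxy⟩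
      rcases (PartialMap.mem_graph_insert (h := hfun)).1 hxy with ⟨hx, -⟩ | h
      · exact absurd (hx ▸ x.2) hb
      · exact h

end IsMLMap

/-! ### Extending to an element of `A` -/

/-- Transfer of a solution of an algebraic formula along tuples of the same type. -/
theorem exists_solution_of_sameType {T : D.L2.Theory} (hT : IsMLTheory.{u, v, w} D T) [M ⊨ T]
    [N ⊨ T] {n : ℕ} {c : Fin n → M} {c' : Fin n → N} (hc : SameType D.Lβ c c') {X : Set (Fin n)}
    {d : X → D.partA M} {d' : X → D.partA N} (hd : SameType D.Lα d d')
    (hX : ∀ i, c i ∈ D.setA M ↔ i ∈ X) (hX' : ∀ i, c' i ∈ D.setA N ↔ i ∈ X)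
    (hdc : ∀ i, (d i : M) = c i) (hdc' : ∀ i, (d' i : N) = c' i)
    (hi : IndepSets D.Lβ (range c) (D.setA M) (c '' X))
    (hi' : IndepSets D.Lβ (range c') (D.setA N) (c' '' X))
    {φ : D.Lβ.Formula (Fin n ⊕ Unit)} (hφ : (solutions D.Lβ φ c).Finite)
    {ψ : D.Lα.Formula (X ⊕ Unit)} {a : D.partA M} (haφ : (a : M) ∈ solutions D.Lβ φ c)
    (haψ : a ∈ solutions D.Lα ψ d) :
    ∃ a' : D.partA N, (a' : N) ∈ solutions D.Lβ φ c' ∧ a' ∈ solutions D.Lα ψ d' := by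
  have := nonempty_of_models D M
  have := nonempty_partA D M
  have hMβ : M ⊨ D.Tβ := modelsTβ
  have hMα : D.partA M ⊨ D.Tα := modelsTα
  obtain ⟨k, hk⟩ := finite_solutions_iff.1 hφ
  let χ : D.Challenge :=
    { n := n
      xα := X
      p := D.Tα.typeOf d
      q := D.Tβ.typeOf c
      φ := φ
      ψ := ψ
      finite := fun K e he => finite_solutions_iff.2
        -- The bound k on the number of solutions is itself a formula of the type of c, so it holds
        -- for every realization of that type.
        ⟨k, he _ (Theory.CompleteType.formula_mem_typeOf.2 hk)⟩ }
  have hdM : (fun i : X => c i) = fun i => (d i : M) := funext fun i => (hdc i).symm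
  have hdN : (fun i : X => c' i) = fun i => (d' i : N) := funext fun i => (hdc' i).symm
  have hcM : IsContender χ c :=
    { mem_iff := hX
      realizes_q := fun θ hθ => Theory.CompleteType.formula_mem_typeOf.1 hθ
      realizes_p := fun θ hθ => by
        rw [hdM, realize_relativize_formula]
        exact Theory.CompleteType.formula_mem_typeOf.1 hθ
      indep := hi }
  have hcN : IsContender χ c' :=
    { mem_iff := hX'
      realizes_q := fun θ hθ => (hc θ).1 (Theory.CompleteType.formula_mem_typeOf.1 hθ)
      realizes_p := fun θ hθ => by
        rw [hdN, realize_relativize_formula]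
        exact (hd θ).1 (Theory.CompleteType.formula_mem_typeOf.1 hθ)
      indep := hi' }
  have helim : ∀ {K : Type w} [D.L2.Structure K] [K ⊨ D.T2] {e : Fin n → K} {e' : X → D.partA K}
      (_ : ∀ i, (e' i : K) = e i) (y : D.partA K),
      (Sum.elim (fun i : X => e i) fun _ : Unit => (y : K)) =
        fun i => ((Sum.elim e' (fun _ => y) i : D.partA K) : K) := by
    intro K _ _ e e' he y
    ext (i | i)
    · exact (he i).symm
    · rfl
  have hsol : IsSolution χ c (a : M) :=
    { contender := hcM
      mem := a.2
      realize_φ := haφ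
      realize_ψ := by
        rw [helim hdc, realize_relativize_formula]
        exact haψ }
  obtain ⟨a', ha'⟩ := hT.mordellLang χ ⟨M, inferInstance, inferInstance, c, a, hsol⟩ N c' hcN
  refine ⟨⟨a', ha'.mem⟩, ha'.realize_φ, ?_⟩
  have h := ha'.realize_ψ
  rw [helim hdc' (⟨a', ha'.mem⟩ : D.partA N), realize_relativize_formula] at h
  exact h

/-- The relation between `b ∈ A` and `b' ∈ A` that allows to extend `f` by `b ↦ b'`. -/
structure SameTypeOver (f : PartialMap M N) (b : D.partA M) (b' : D.partA N) : Prop where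
  sameType_β : SameType D.Lβ (Sum.elim (fun p : f.graph => p.1.1) fun _ : Unit => (b : M))
    (Sum.elim (fun p : f.graph => p.1.2) fun _ : Unit => (b' : N))
  sameType_α : SameType D.Lα
    (Sum.elim (fun p : (f.restrict (D.partA M) (D.partA N)).graph => p.1.1) fun _ : Unit => b)
    (Sum.elim (fun p : (f.restrict (D.partA M) (D.partA N)).graph => p.1.2) fun _ : Unit => b')

variable {f : PartialMap M N}

/-- The Mordell-Lang condition treats one pair of formulas at a time. Finiteness of the solutions of
φ upgrades this to both complete types simultaneously. -/
theorem IsMLMap.exists_sameTypeOver_of_mem_acl {T : D.L2.Theory} (hT : IsMLTheory.{u, v, w} D T)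
    [M ⊨ T] [N ⊨ T] (hf : D.IsMLMap f) (b : D.partA M) (hb : (b : M) ∈ acl D.Lβ f.dom) :
    ∃ b' : D.partA N, SameTypeOver f b b' := by
  have := hf.finite.to_subtype
  obtain ⟨n, ⟨e⟩⟩ := Finite.exists_equiv_fin f.graph
  let c : Fin n → M := fun i => (e.symm i).1.1
  let c' : Fin n → N := fun i => (e.symm i).1.2
  let X : Set (Fin n) := {i | c i ∈ D.setA M}
  have hmem : ∀ i, c i ∈ D.setA M ↔ c' i ∈ D.setA N := fun i => hf.mem_setA_iff (e.symm i).2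
  let d : X → D.partA M := fun i => ⟨c i, i.2⟩
  let d' : X → D.partA N := fun i => ⟨c' i, (hmem i).1 i.2⟩
  have hc : SameType D.Lβ c c' := hf.elementary_β.sameType fun i => (e.symm i).2
  have hd : SameType D.Lα d d' := hf.elementary_α.sameType fun i => (e.symm i).2
  have hrc : range c = f.dom := by
    rw [← f.range_fst]
    exact e.symm.surjective.range_comp fun p : f.graph => p.1.1
  have hrc' : range c' = f.ran := by
    rw [← f.range_snd]
    exact e.symm.surjective.range_comp fun p : f.graph => p.1.2
  have hXc : c '' X = D.setA M ∩ f.dom := by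
    rw [← hrc, inter_comm, ← image_univ, ← image_inter_preimage, univ_inter]
    rfl
  have hXc' : c' '' X = D.setA N ∩ f.ran := by
    have hX : X = c' ⁻¹' D.setA N := ext hmem
    rw [← hrc', inter_comm, ← image_univ, ← image_inter_preimage, univ_inter, hX]
  rw [← hrc] at hb
  obtain ⟨φ, hbφ, hφ⟩ := mem_acl_range_iff.1 hb
  have : Nonempty (typeSet D.Lβ c (b : M) × typeSet D.Lα d b) := ⟨⟨φ, hbφ⟩, ⟨⊤, BoundedFormula.realize_top.2 trivial⟩⟩
  obtain ⟨b', -, hb'⟩ := exists_forall_of_finite (J := typeSet D.Lβ c (b : M) × typeSet D.Lα d b)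
    (F := ((↑) : D.partA N → N) ⁻¹' solutions D.Lβ φ c')
    (P := fun j y => (y : N) ∈ solutions D.Lβ j.1.1 c' ∧ y ∈ solutions D.Lα j.2.1 d')
    (((hc.finite_solutions_iff φ).1 hφ).preimage Subtype.coe_injective.injOn)
    (fun i j => ⟨⟨⟨i.1.1 ⊓ j.1.1, Formula.realize_inf.2 ⟨i.1.2, j.1.2⟩⟩,
        ⟨i.2.1 ⊓ j.2.1, Formula.realize_inf.2 ⟨i.2.2, j.2.2⟩⟩⟩, fun y hy =>
      ⟨⟨(Formula.realize_inf.1 hy.1).1, (Formula.realize_inf.1 hy.2).1⟩,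
        ⟨(Formula.realize_inf.1 hy.1).2, (Formula.realize_inf.1 hy.2).2⟩⟩⟩)
    (fun j => by
      obtain ⟨y, hy, hy'⟩ := exists_solution_of_sameType hT hc hd (fun _ => Iff.rfl)
        (fun i => (hmem i).symm) (fun _ => rfl) (fun _ => rfl)
        (by rw [hrc, hXc]; exact hf.indep_dom) (by rw [hrc', hXc']; exact hf.indep_ran)
        -- The conjunct φ makes the formula algebraic and keeps the answer in the fixed finite set.
        (φ := φ ⊓ j.1.1) (hφ.subset fun y hy => (Formula.realize_inf.1 hy).1)
        (Formula.realize_inf.2 ⟨hbφ, j.1.2⟩) j.2.2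
      exact ⟨y, (Formula.realize_inf.1 hy).1, (Formula.realize_inf.1 hy).2, hy'⟩)
  refine ⟨b', ?_, ?_⟩
  · refine SameType.of_forall_exists (c := Sum.elim c fun _ : Unit => (b : M))
      (c' := Sum.elim c' fun _ : Unit => (b' : N))
      (SameType.of_imp fun θ hθ => (hb' ⟨⟨θ, hθ⟩, ⟨⊤, BoundedFormula.realize_top.2 trivial⟩⟩).1) ?_
    rintro (p | i)
    · exact ⟨Sum.inl (e p), by simp [c], by simp [c']⟩
    · exact ⟨Sum.inr (), rfl, rfl⟩
  · refine SameType.of_forall_exists (c := Sum.elim d fun _ : Unit => b)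
      (c' := Sum.elim d' fun _ : Unit => b')
      (SameType.of_imp fun θ hθ => (hb' ⟨⟨φ, hbφ⟩, ⟨θ, hθ⟩⟩).2) ?_
    rintro (⟨⟨x, y⟩, hp⟩ | i)
    · have hex : e.symm (e ⟨(x.1, y.1), hp⟩) = ⟨(x.1, y.1), hp⟩ := e.symm_apply_apply _
      have hcx : c (e ⟨(x.1, y.1), hp⟩) = x := by simp only [c, hex]
      have hcy : c' (e ⟨(x.1, y.1), hp⟩) = y := by simp only [c', hex]
      exact ⟨Sum.inl ⟨e ⟨(x.1, y.1), hp⟩, show c _ ∈ D.setA M by rw [hcx]; exact x.2⟩,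
        Subtype.ext hcx, Subtype.ext hcy⟩
    · exact ⟨Sum.inr (), rfl, rfl⟩

/-- Density and codensity speak of types over the parameter set `f.ran`; this returns to tuples
indexed by the graph. -/
theorem IsMLMap.sameType_of_ran (hf : D.IsMLMap f) {c : f.ran → M}
    (hc : ∀ y, (c y, (y : N)) ∈ f.graph) {b : M} {b' : N}
    (hb' : ∀ φ ∈ typeSet D.Lβ c b, b' ∈ solutions D.Lβ φ ((↑) : f.ran → N)) :
    SameType D.Lβ (Sum.elim (fun p : f.graph => p.1.1) fun _ : Unit => b)
      (Sum.elim (fun p : f.graph => p.1.2) fun _ : Unit => b') := by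
  refine SameType.of_forall_exists (c := Sum.elim c fun _ : Unit => b)
    (c' := Sum.elim ((↑) : f.ran → N) fun _ : Unit => b') (SameType.of_imp hb') ?_
  rintro (⟨⟨x, y⟩, hp⟩ | i)
  · exact ⟨Sum.inl ⟨y, x, hp⟩, hf.elementary_β.injective (hc ⟨y, x, hp⟩) hp, rfl⟩
  · exact ⟨Sum.inr (), rfl, rfl⟩

theorem IsMLMap.exists_sameTypeOver_of_notMem_acl (hβ : IsGeometric.{u, v, w} D.Tβ)
    {T : D.L2.Theory} (hT : IsMLTheory.{u, v, w} D T)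
    {κ : Cardinal.{w}} (hκ : Cardinal.lift.{w} D.cardT2 < Cardinal.lift.{max u v} κ)
    [N ⊨ T] (hN : IsSaturated D.L2 N κ) (hf : D.IsMLMap f) (b : D.partA M)
    (hb : (b : M) ∉ acl D.Lβ f.dom) : ∃ b' : D.partA N, SameTypeOver f b b' := by
  obtain ⟨c, hc⟩ := f.exists_tuple_of_ran
  have hcs : SameType D.Lβ c ((↑) : f.ran → N) := hf.elementary_β.sameType hc
  have hden := (density_codensity_of_finite hT hκ hN hf.finite_ran hcs fun h =>
    hb ((pregeometry hβ).mono _ _ (PartialMap.range_tuple_subset hc) h)).1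
  let d : D.paramsA N f.ran → D.partA M := fun y =>
    ⟨c ⟨(y : D.partA N), y.2⟩, (hf.mem_setA_iff (hc ⟨_, y.2⟩)).2 y.1.2⟩
  have hds : SameType D.Lα d ((↑) : D.paramsA N f.ran → D.partA N) :=
    hf.elementary_α.sameType fun y => hc ⟨(y : D.partA N), y.2⟩
  obtain ⟨b', hb'A, hb'α, hb'β⟩ := hden (typeSet D.Lα d b) (hds.isTypeOver b) (by
    -- Compatibility of the two types: b satisfies θ in 𝓐 if and only if it does in 𝓑, as θ is
    -- quantifier-free.
    intro θ hθ hmem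
    have h := (realize_inclLβ_iff_of_isQF hθ _).2 hmem
    change (D.toLβOver N f.ran θ).Realize _
    rw [toLβOver, Formula.realize_relabel]
    convert h using 1
    ext (i | i) <;> rfl)
  refine ⟨⟨b', hb'A⟩, hf.sameType_of_ran hc hb'β, ?_⟩
  refine SameType.of_forall_exists (c := Sum.elim d fun _ : Unit => b)
    (c' := Sum.elim ((↑) : D.paramsA N f.ran → D.partA N)
      fun _ : Unit => (⟨b', hb'A⟩ : D.partA N)) (SameType.of_imp fun ψ hψ => ?_) ?_
  · have h := hb'α ψ hψ
    rw [← realize_relativize_formula]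
    convert h using 1
    ext (i | i) <;> rfl
  · rintro (⟨⟨x, y⟩, hp⟩ | i)
    · exact ⟨Sum.inl ⟨y, x, hp⟩,
        Subtype.ext (hf.elementary_β.injective (hc ⟨y, x, hp⟩) hp), rfl⟩
    · exact ⟨Sum.inr (), rfl, rfl⟩

/-- An element of `A` enters both the domain and the base of the independence relation, so
independence persists whether or not it is algebraic. -/
theorem IsMLMap.exists_extends_of_mem_setA (hβ : IsGeometric.{u, v, w} D.Tβ)
    {T : D.L2.Theory} (hT : IsMLTheory.{u, v, w} D T)
    {κ : Cardinal.{w}} (hκ : Cardinal.lift.{w} D.cardT2 < Cardinal.lift.{max u v} κ)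
    [M ⊨ T] [N ⊨ T] (hN : IsSaturated D.L2 N κ) (hf : D.IsMLMap f) {b : M} (hb : b ∈ D.setA M) :
    ∃ g ∈ D.mlMaps M N, g.Extends f ∧ b ∈ g.dom := by
  obtain ⟨b', hb'⟩ : ∃ b' : D.partA N, SameTypeOver f (⟨b, hb⟩ : D.partA M) b' := by
    by_cases hacl : b ∈ acl D.Lβ f.dom
    · exact hf.exists_sameTypeOver_of_mem_acl hT ⟨b, hb⟩ hacl
    · exact hf.exists_sameTypeOver_of_notMem_acl hβ hT hκ hN ⟨b, hb⟩ hacl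
  have hb'A : (b' : N) ∈ D.setA N := b'.2
  obtain ⟨g, hg, hgf, hbg⟩ := hf.exists_insert hβ hb'.sameType_β (iff_of_true hb hb'A)
    (fun _ _ => hb'.sameType_α)
    (by
      rw [inter_insert_of_mem hb]
      exact (pregeometry hβ).clIndep_insert_of_mem
        ((indepSets_iff_clIndep (pregeometry hβ) hf.finite_dom).1 hf.indep_dom) hb)
    (by
      rw [inter_insert_of_mem hb'A]
      exact (pregeometry hβ).clIndep_insert_of_mem
        ((indepSets_iff_clIndep (pregeometry hβ) hf.finite_ran).1 hf.indep_ran) hb'A)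
  exact ⟨g, hg, hgf, b', hbg⟩

end PairSetup

end MLPair

namespace MLPair

namespace PairSetup

variable {S : FirstOrder.Language.{u, v}} {D : PairSetup S} {M N : Type w} [D.L2.Structure M]
  [D.L2.Structure N] [M ⊨ D.T2] [N ⊨ D.T2]

/-! ### Back and forth -/

namespace IsMLMap

variable {f : PartialMap M N}

theorem exists_extends_ran_of_finite (hβ : IsGeometric.{u, v, w} D.Tβ)
    {T : D.L2.Theory} (hT : IsMLTheory.{u, v, w} D T)
    {κ : Cardinal.{w}} (hκ : Cardinal.lift.{w} D.cardT2 < Cardinal.lift.{max u v} κ)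
    [M ⊨ T] [N ⊨ T] (hM : IsSaturated D.L2 M κ) (hf : D.IsMLMap f) {Y : Set N} (hY : Y.Finite)
    (hYA : Y ⊆ D.setA N) : ∃ g ∈ D.mlMaps M N, g.Extends f ∧ Y ⊆ g.ran := by
  obtain ⟨h, hh, hext, hdom⟩ := PartialMap.exists_extends_of_finite (I := D.mlMaps N M)
    (P := fun b => b ∈ D.setA N)
    (fun g hg b hb => IsMLMap.exists_extends_of_mem_setA hβ hT hκ hM hg hb) hY hYA hf.inverse
  exact ⟨_, IsMLMap.inverse hh, fun _ hxy => hext hxy, hdom⟩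

theorem exists_extends_of_mem_acl (hβ : IsGeometric.{u, v, w} D.Tβ)
    {T : D.L2.Theory} (hT : IsMLTheory.{u, v, w} D T)
    {κ : Cardinal.{w}} (hκ : Cardinal.lift.{w} D.cardT2 < Cardinal.lift.{max u v} κ)
    [M ⊨ T] [N ⊨ T] (hM : IsSaturated D.L2 M κ) (hN : IsSaturated D.L2 N κ) (hf : D.IsMLMap f)
    {b : M} (hb : b ∈ acl D.Lβ f.dom) : ∃ g ∈ D.mlMaps M N, g.Extends f ∧ b ∈ g.dom := by
  by_cases hbA : b ∈ D.setA M
  · exact hf.exists_extends_of_mem_setA hβ hT hκ hN hbA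
  rw [← f.range_fst] at hb
  obtain ⟨φ, hbφ, hφ⟩ := mem_acl_range_iff.1 hb
  have hφ' := (SameType.finite_solutions_iff (L := D.Lβ) hf.elementary_β φ).1 hφ
  -- Every candidate for the image of b that lies in `A` is put into the range beforehand.
  obtain ⟨g, hg, hgf, hYg⟩ := hf.exists_extends_ran_of_finite hβ hT hκ hM
    (hφ'.inter_of_left (D.setA N)) inter_subset_right
  have hg : D.IsMLMap g := hg
  let φg : D.Lβ.Formula (g.graph ⊕ Unit) := φ.relabel (Sum.map (inclusion hgf) id)
  have hsol : ∀ {K : Type w} [D.L2.Structure K] (pr : M × N → K),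
      solutions D.Lβ φg (fun p : g.graph => pr p.1) =
        solutions D.Lβ φ (fun p : f.graph => pr p.1) := by
    intro K _ pr
    ext y
    rw [mem_solutions, mem_solutions, Formula.realize_relabel, iff_eq_eq]
    congr 1
    ext (i | i) <;> rfl
  have hbφg : b ∈ solutions D.Lβ φg (fun p : g.graph => p.1.1) := hsol Prod.fst ▸ hbφ
  have hφg : (solutions D.Lβ φg (fun p : g.graph => p.1.1)).Finite := hsol Prod.fst ▸ hφ
  obtain ⟨b', hbb'⟩ := SameType.exists_of_finite_solutions (L := D.Lβ) hg.elementary_β hbφg hφg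
  have hb'φg : b' ∈ solutions D.Lβ φg (fun p : g.graph => p.1.2) := (hbb' φg).1 hbφg
  have hφg' := (SameType.finite_solutions_iff (L := D.Lβ) hg.elementary_β φg).1 hφg
  have hb'A : b' ∉ D.setA N := by
    intro hb'A
    -- An image in `A` would already be the image of some x; equality of types forces x = b, and
    -- then b would lie in `A`.
    obtain ⟨x, hx⟩ := hYg ⟨hsol Prod.snd ▸ hb'φg, hb'A⟩
    have hxb : x = b := (hbb'.eq_iff (Sum.inl ⟨_, hx⟩) (Sum.inr ())).2 rfl
    exact hbA (hxb ▸ (hg.mem_setA_iff hx).2 hb'A)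
  obtain ⟨k, hk, hkg, hbk⟩ := hg.exists_insert hβ hbb' (iff_of_false hbA hb'A)
    (fun h _ => absurd h hbA)
    (by
      rw [inter_insert_of_notMem hbA]
      refine (pregeometry hβ).clIndep_insert_of_mem_cl hg.finite_dom
        ((indepSets_iff_clIndep (pregeometry hβ) hg.finite_dom).1 hg.indep_dom) ?_
      rw [← g.range_fst]
      exact mem_acl_range_iff.2 ⟨φg, hbφg, hφg⟩)
    (by
      rw [inter_insert_of_notMem hb'A]
      refine (pregeometry hβ).clIndep_insert_of_mem_cl hg.finite_ran
        ((indepSets_iff_clIndep (pregeometry hβ) hg.finite_ran).1 hg.indep_ran) ?_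
      rw [← g.range_snd]
      exact mem_acl_range_iff.2 ⟨φg, hb'φg, hφg'⟩)
  exact ⟨k, hk, hkg.trans hgf, b', hbk⟩

/-- The element from codensity avoids acl(`A` ∪ `f.ran`), hence avoids `A`, and stays free over
everything that independence refers to. -/
theorem exists_extends_of_notMem_acl (hβ : IsGeometric.{u, v, w} D.Tβ)
    {T : D.L2.Theory} (hT : IsMLTheory.{u, v, w} D T)
    {κ : Cardinal.{w}} (hκ : Cardinal.lift.{w} D.cardT2 < Cardinal.lift.{max u v} κ)
    [N ⊨ T] (hN : IsSaturated D.L2 N κ) (hf : D.IsMLMap f)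
    {b : M} (hb : b ∉ acl D.Lβ (D.setA M ∪ f.dom)) :
    ∃ g ∈ D.mlMaps M N, g.Extends f ∧ b ∈ g.dom := by
  have hM' := pregeometry (M := M) hβ
  have hN' := pregeometry (M := N) hβ
  obtain ⟨c, hc⟩ := f.exists_tuple_of_ran
  have hcs : SameType D.Lβ c ((↑) : f.ran → N) := hf.elementary_β.sameType hc
  obtain ⟨b', hb', hb'q⟩ := (density_codensity_of_finite hT hκ hN hf.finite_ran hcs fun h =>
    hb (hM'.mono _ _ ((PartialMap.range_tuple_subset hc).trans subset_union_right) h)).2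
  have hbA : b ∉ D.setA M := fun h => hb (hM'.mem_cl (Or.inl h))
  have hb'A : b' ∉ D.setA N := fun h => hb' (hN'.mem_cl (Or.inl h))
  obtain ⟨k, hk, hkf, hbk⟩ := hf.exists_insert hβ (hf.sameType_of_ran hc hb'q)
    (iff_of_false hbA hb'A) (fun h _ => absurd h hbA)
    (by
      rw [inter_insert_of_notMem hbA]
      refine hM'.clIndep_insert_of_notMem_cl
        ((indepSets_iff_clIndep hM' hf.finite_dom).1 hf.indep_dom) ?_
      rwa [union_eq_self_of_subset_right inter_subset_left])
    (by
      rw [inter_insert_of_notMem hb'A]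
      refine hN'.clIndep_insert_of_notMem_cl
        ((indepSets_iff_clIndep hN' hf.finite_ran).1 hf.indep_ran) ?_
      rwa [union_eq_self_of_subset_right inter_subset_left])
  exact ⟨k, hk, hkf, b', hbk⟩

theorem forth (hβ : IsGeometric.{u, v, w} D.Tβ)
    {T : D.L2.Theory} (hT : IsMLTheory.{u, v, w} D T)
    {κ : Cardinal.{w}} (hκ : Cardinal.lift.{w} D.cardT2 < Cardinal.lift.{max u v} κ)
    [M ⊨ T] [N ⊨ T] (hM : IsSaturated D.L2 M κ) (hN : IsSaturated D.L2 N κ) (hf : D.IsMLMap f)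
    (b : M) : ∃ g ∈ D.mlMaps M N, g.Extends f ∧ b ∈ g.dom := by
  by_cases hb : b ∈ acl D.Lβ (D.setA M ∪ f.dom)
  · obtain ⟨X, hX, hXfin, hbX⟩ := (pregeometry hβ).finitary _ _ hb
    obtain ⟨g, hg, hgf, hXg⟩ := PartialMap.exists_extends_of_finite (I := D.mlMaps M N)
      (P := fun a => a ∈ D.setA M)
      (fun g hg a ha => IsMLMap.exists_extends_of_mem_setA hβ hT hκ hN hg ha)
      (hXfin.inter_of_left (D.setA M)) (fun _ h => h.2) hf
    have hXsub : X ⊆ g.dom := fun x hx => (hX hx).elim (fun h => hXg ⟨hx, h⟩)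
      fun h => hgf.dom_subset h
    obtain ⟨k, hk, hkg, hbk⟩ := IsMLMap.exists_extends_of_mem_acl hβ hT hκ hM hN hg
      ((pregeometry hβ).mono _ _ hXsub hbX)
    exact ⟨k, hk, hkg.trans hgf, hbk⟩
  · exact hf.exists_extends_of_notMem_acl hβ hT hκ hN hb

theorem back (hβ : IsGeometric.{u, v, w} D.Tβ)
    {T : D.L2.Theory} (hT : IsMLTheory.{u, v, w} D T)
    {κ : Cardinal.{w}} (hκ : Cardinal.lift.{w} D.cardT2 < Cardinal.lift.{max u v} κ)
    [M ⊨ T] [N ⊨ T] (hM : IsSaturated D.L2 M κ) (hN : IsSaturated D.L2 N κ) (hf : D.IsMLMap f)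
    (b : N) : ∃ g ∈ D.mlMaps M N, g.Extends f ∧ b ∈ g.ran := by
  obtain ⟨h, hh, hext, hdom⟩ := hf.inverse.forth hβ hT hκ hN hM b
  exact ⟨_, IsMLMap.inverse hh, fun _ hxy => hext hxy, hdom⟩

end IsMLMap

/-! ### Preservation of quantifier-free formulas -/

namespace IsMLMap

variable {f : PartialMap M N}

/-- Values of terms need not lie in the domain. After extending, elementarity for the formula t = y
shows that the map sends the value of t to the value of t at the images. -/
theorem exists_extends_term (hβ : IsGeometric.{u, v, w} D.Tβ)
    {T : D.L2.Theory} (hT : IsMLTheory.{u, v, w} D T)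
    {κ : Cardinal.{w}} (hκ : Cardinal.lift.{w} D.cardT2 < Cardinal.lift.{max u v} κ)
    [M ⊨ T] [N ⊨ T] (hN : IsSaturated D.L2 N κ) (hf : D.IsMLMap f) {n : ℕ}
    (t : Fin n → D.Lβ.Term f.graph)
    (ht : ∀ i, (t i).realize (fun p => p.1.1) ∈ D.setA M) :
    ∃ g ∈ D.mlMaps M N, ∀ i,
      ((t i).realize (fun p => p.1.1), (t i).realize (fun p => p.1.2)) ∈ g.graph := by
  obtain ⟨g, hg, hgf, hdom⟩ := PartialMap.exists_extends_of_finite (I := D.mlMaps M N)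
    (P := fun a => a ∈ D.setA M)
    (fun g hg a ha => IsMLMap.exists_extends_of_mem_setA hβ hT hκ hN hg ha)
    (finite_range fun i => (t i).realize (fun p : f.graph => p.1.1))
    (by rintro _ ⟨i, rfl⟩; exact ht i) hf
  refine ⟨g, hg, fun i => ?_⟩
  obtain ⟨y, hy⟩ := hdom ⟨i, rfl⟩
  have h : SameType D.Lβ
      (Sum.elim (fun p : f.graph => p.1.1) fun _ : Unit => (t i).realize fun p => p.1.1)
      (Sum.elim (fun p : f.graph => p.1.2) fun _ : Unit => y) := by
    refine hg.elementary_β.sameType ?_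
    rintro (p | _)
    · exact hgf p.2
    · exact hy
  have h' := h (((t i).relabel Sum.inl).equal (Term.var (Sum.inr ())))
  simp only [Formula.realize_equal, Term.realize_relabel, Term.realize_var, Sum.elim_inr,
    Sum.elim_comp_inl, true_iff] at h'
  rw [h']
  exact hy

/-- Relations of `Lβ` follow from `Lβ`-elementarity. For the others, and for `A` itself, the
arguments lie in `A`; once they belong to the domain of an extension, its conditions on `A` apply.
-/
theorem relMap_of_relMap (hβ : IsGeometric.{u, v, w} D.Tβ)
    {T : D.L2.Theory} (hT : IsMLTheory.{u, v, w} D T)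
    {κ : Cardinal.{w}} (hκ : Cardinal.lift.{w} D.cardT2 < Cardinal.lift.{max u v} κ)
    [M ⊨ T] [N ⊨ T] (hN : IsSaturated D.L2 N κ) (hf : D.IsMLMap f) {n : ℕ}
    (R : D.L2.Relations n) (t : Fin n → D.Lβ.Term f.graph)
    (h : Structure.RelMap R fun i => (t i).realize fun p => p.1.1) :
    Structure.RelMap R fun i => (t i).realize fun p => p.1.2 := by
  rcases R with ⟨R, hR⟩ | R
  · by_cases hRβ : R ∈ D.β.rels n
    · let R' : D.Lβ.Relations n := ⟨R, hRβ⟩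
      have hs := hf.elementary_β (Relations.formula R' t)
      rw [Formula.realize_rel, Formula.realize_rel] at hs
      exact hs.1 h
    · have hRα : R ∈ D.α.rels n := hR.resolve_right hRβ
      let R' : D.Lα.Relations n := ⟨R, hRα⟩
      have hmem := mem_setA_of_relMap R' hRβ h
      obtain ⟨g, hg, hgt⟩ := hf.exists_extends_term hβ hT hκ hN t hmem
      have hmem' := fun i => (IsMLMap.mem_setA_iff hg (hgt i)).1 (hmem i)
      have hs : SameType D.Lα (fun i => (⟨_, hmem i⟩ : D.partA M))
          (fun i => (⟨_, hmem' i⟩ : D.partA N)) := hg.elementary_α.sameType hgt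
      have hR := hs (Relations.formula R' fun i => Term.var i)
      rw [Formula.realize_rel, Formula.realize_rel] at hR
      exact hR.1 h
  · cases R
    have h1 : ∀ {K : Type w} [D.L2.Structure K] (x : Fin 1 → K),
        Structure.RelMap D.symbA x ↔ x 0 ∈ D.setA K := by
      intro K _ x
      have hx : x = ![x 0] := by
        ext i
        rw [Subsingleton.elim i 0]
        rfl
      exact (congrArg (Structure.RelMap D.symbA) hx).to_iff
    refine (h1 _).2 ?_
    have hmem := (h1 _).1 h
    obtain ⟨g, hg, hgt⟩ := hf.exists_extends_term hβ hT hκ hN t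
      (fun i => by rw [Subsingleton.elim i 0]; exact hmem)
    exact (IsMLMap.mem_setA_iff hg (hgt 0)).1 hmem

theorem relMap_iff (hβ : IsGeometric.{u, v, w} D.Tβ)
    {T : D.L2.Theory} (hT : IsMLTheory.{u, v, w} D T)
    {κ : Cardinal.{w}} (hκ : Cardinal.lift.{w} D.cardT2 < Cardinal.lift.{max u v} κ)
    [M ⊨ T] [N ⊨ T] (hM : IsSaturated D.L2 M κ) (hN : IsSaturated D.L2 N κ) (hf : D.IsMLMap f)
    {n : ℕ} (R : D.L2.Relations n) (t : Fin n → D.Lβ.Term f.graph) :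
    (Structure.RelMap R fun i => (t i).realize fun p => p.1.1) ↔
      Structure.RelMap R fun i => (t i).realize fun p => p.1.2 := by
  refine ⟨hf.relMap_of_relMap hβ hT hκ hN R t, fun h => ?_⟩
  let e : f.graph → (f.inverse hf.elementary_β.injective).graph := fun p => ⟨(p.1.2, p.1.1), p.2⟩
  have := hf.inverse.relMap_of_relMap hβ hT hκ hM R (fun i => (t i).relabel e)
  simp only [Term.realize_relabel] at this
  exact this h

theorem isPartialIso (hβ : IsGeometric.{u, v, w} D.Tβ)
    {T : D.L2.Theory} (hT : IsMLTheory.{u, v, w} D T)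
    {κ : Cardinal.{w}} (hκ : Cardinal.lift.{w} D.cardT2 < Cardinal.lift.{max u v} κ)
    [M ⊨ T] [N ⊨ T] (hM : IsSaturated D.L2 M κ) (hN : IsSaturated D.L2 N κ) (hf : D.IsMLMap f) :
    f.IsPartialIso D.L2 := by
  have hterm : ∀ t : D.L2.Term (f.graph ⊕ Fin 0), ∃ t' : D.Lβ.Term f.graph,
      ∀ {K : Type w} [D.L2.Structure K] (v : f.graph → K) (xs : Fin 0 → K),
        t.realize (Sum.elim v xs) = t'.realize v := by
    intro t
    obtain ⟨t', rfl⟩ := exists_onTerm_eq t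
    refine ⟨t'.relabel (Sum.elim id fun i => i.elim0), fun v xs => ?_⟩
    rw [LHom.realize_onTerm, Term.realize_relabel]
    congr 1
    ext (i | i)
    · rfl
    · exact i.elim0
  intro φ hφ
  unfold Formula.Realize
  induction hφ with
  | falsum => rfl
  | of_isAtomic h =>
    cases h with
    | equal t₁ t₂ =>
      obtain ⟨s₁, h₁⟩ := hterm t₁
      obtain ⟨s₂, h₂⟩ := hterm t₂
      simp only [BoundedFormula.realize_bdEqual, h₁, h₂]
      simpa only [Formula.realize_equal] using hf.elementary_β (s₁.equal s₂)
    | rel R ts =>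
      choose s hs using fun i => hterm (ts i)
      simp only [BoundedFormula.realize_rel, hs]
      exact hf.relMap_iff hβ hT hκ hM hN R s
  | imp _ _ ih₁ ih₂ => exact imp_congr ih₁ ih₂

end IsMLMap

end PairSetup

end MLPair

/-! ### The main theorem -/

theorem mainTheorem5 {S : FirstOrder.Language.{u, v}} (D : MLPair.PairSetup S)
    (hβ : MLPair.IsGeometric.{u, v, w} D.Tβ)
    (T : D.L2.Theory) (hcons : T.IsSatisfiable)
    (hT : MLPair.PairSetup.IsMLTheory.{u, v, w} D T)
    (κ : Cardinal.{w}) (hκ : Cardinal.lift.{w} D.cardT2 < Cardinal.lift.{max u v} κ)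
    (M₁ M₂ : Type w) [D.L2.Structure M₁] [D.L2.Structure M₂]
    [M₁ ⊨ D.T2] [M₁ ⊨ T] [M₂ ⊨ D.T2] [M₂ ⊨ T]
    (hM₁ : MLPair.IsSaturated D.L2 M₁ κ) (hM₂ : MLPair.IsSaturated D.L2 M₂ κ) :
    MLPair.PartialMap.IsBackAndForthSystem D.L2 (D.mlMaps M₁ M₂) ∧
      ∀ ι ∈ D.mlMaps M₁ M₂, ι.IsElementary D.L2 := by
  have h : MLPair.PartialMap.IsBackAndForthSystem D.L2 (D.mlMaps M₁ M₂) :=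
    { partialIso := fun f hf =>
        MLPair.PairSetup.IsMLMap.isPartialIso hβ hT hκ hM₁ hM₂ hf
      forth := fun f hf b => MLPair.PairSetup.IsMLMap.forth hβ hT hκ hM₁ hM₂ hf b
      back := fun f hf b => MLPair.PairSetup.IsMLMap.back hβ hT hκ hM₁ hM₂ hf b }
  exact ⟨h, fun ι hι => h.isElementary hι⟩
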